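/- Setting. Let $\mu,c_s,\sigma>0$, and identify the boundary of the half space $\mathbb{R}^3_+$ with $\mathbb{R}^2$. Let $G\subset\mathbb{R}^2$ be a bounded Lipschitz open set. For a (real) distribution $u$ on $\mathbb{R}\times\mathbb{R}^2$ let $\hat u(\omega,\xi)=\iint e^{i\omega t-ix\cdot\xi}u(t,x)\,dx\,dt$ on the line $\mathrm{Im}\,\omega=\sigma$. Put $\|v\|_{r,\omega}^2=\int_{\mathbb{R}^2}(|\omega|^2+|\xi|^2)^r|\hat v(\xi)|^2d\xi$ for $v\in H^r(\mathbb{R}^2)$, $\tilde H^r(A)=\{v\in H^r(\mathbb{R}^2):\mathrm{supp}\,v\subset\overline A\}$, $H^r(G)=H^r(\mathbb{R}^2)/\tilde H^r(\mathbb{R}^2\setminus\overline G)$ with the quotient norms $\|f\|_{r,\omega,G}=\inf_{v\in \tilde H^r(\mathbb{R}^2\setminus\overline G)}\|f+v\|_{r,\omega}$, and $$\|u\|_{s,r,\sigma,*}^2=\int_{\mathrm{Im}\,\omega=\sigma}|\omega|^{2s}\|\hat u(\omega)\|_{r,\omega}^2\,d\omega,\qquad \|f\|_{s,r,\sigma}^2=\int_{\mathrm{Im}\,\omega=\sigma}|\omega|^{2s}\|\hat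 f(\omega)\|_{r,\omega,G}^2\,d\omega .$$ $H^s_\sigma(\mathbb{R}^+,\tilde H^r(G))$ and $H^s_\sigma(\mathbb{R}^+,H^r(G))$ are the spaces of real distributions in $t$, supported in $t\ge0$, with values in $\tilde H^r(G)$, respectively $H^r(G)$, with $e^{-\sigma t}u$ tempered and finite norm; a superscript $+$ denotes the nonnegative elements. Let $\langle\cdot,\cdot\rangle_\sigma$ be the duality pairing extending $\int_0^\infty e^{-2\sigma t}\int_G fv\,dx\,dt$. The Dirichlet-to-Neumann operator $\mathcal{S}_\sigma$ of the half space is defined by $\widehat{\mathcal{S}_\sigma u}(\omega,\xi)=-i\mu\sqrt{c_s^{-2}\omega^2-|\xi|^2}\;\hat u(\omega,\xi)$, $\mathrm{Im}\,\omega=\sigma$, with the root of positive imaginary part, and $p_Q$ is the restriction to $Q=\mathbb{R}\times G$. Discretisation. Let $\mathcal{T}_S$ be a finite triangulation of $\overline G$, $\Delta t>0$, and $p,q\ge1$. Let $V_t^p$ be the continuous piecewise polynomials of degree at most $p$ on the uniform time grid $t_n=n\Delta t$, vanishing at $t=0$ (on all of $[0,\infty)$, or on $[0,N\Delta t]$ and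 vanishing from $N\Delta t$ on), and let $\tilde V_h^q$ be the continuous piecewise polynomials of degree at most $q$ on $\mathcal{T}_S$ vanishing on $\partial G$; both are extended by zero. Let $\tilde K^+_{t,h}$ be the set of nonnegative functions in $V_t^p\otimes\tilde V_h^q$ that belong to $H^{1/2}_\sigma(\mathbb{R}^+,\tilde H^{1/2}(G))$. Theorem. For all $\mu,c_s,\sigma>0$ there is a constant $C$, depending only on $\sigma$, $\mu$ and $c_s$, with the following property. Let $G$ and the discretisation be as above, $h\in H^{3/2}_\sigma(\mathbb{R}^+,H^{-1/2}(G))$, and let $u\in H^{1/2}_\sigma(\mathbb{R}^+,\tilde H^{1/2}(G))^+$ and $u_{\Delta t,h}\in\tilde K^+_{t,h}$ satisfy $$\langle p_Q\mathcal{S}_\sigma u,v-u\rangle_\sigma\ge\langle h,v-u\rangle_\sigma\quad\text{for all }v\in H^{1/2}_\sigma(\mathbb{R}^+,\tilde H^{1/2}(G))^+,$$ $$\langle p_Q\mathcal{S}_\sigma u_{\Delta t,h},v-u_{\Delta t,h}\rangle_\sigma\ge\langle h,v-u_{\Delta t,h}\rangle_\sigma\quad\text{for all }v\in\tilde K^+_{t,h}.$$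 Then $$\|u-u_{\Delta t,h}\|^2_{-\frac12,\frac12,\sigma,*}\le C\inf_{\phi\in\tilde K^+_{t,h}}\Big(\|h-p_Q\mathcal{S}_\sigma u\|_{\frac12,-\frac12,\sigma}\,\|u-\phi\|_{-\frac12,\frac12,\sigma,*}+\|u-\phi\|^2_{\frac12,\frac12,\sigma,*}\Big).$$ -/

import Mathlib

open MeasureTheory Set TopologicalSpace
open scoped ENNReal NNReal Topology Distributions

noncomputable section

namespace FlatContact

/-! Flat contact for the wave equation in the half space `ℝ³₊`.  The boundary of the half space is
the plane `ℝ²`, time is `ℝ`, and space-time on the boundary is `ℝ × ℝ²`. -/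

/-- The boundary plane of the half space. -/
abbrev Plane : Type := EuclideanSpace ℝ (Fin 2)

/-- Space-time on the boundary (the time variable is the first component). -/
abbrev SpaceTime : Type := ℝ × Plane

/-- The whole of space-time as an open set. -/
abbrev wholeST : Opens SpaceTime := ⊤

/-- The open set `Q = ℝ × G`. -/
def cylinder (G : Opens Plane) : Opens SpaceTime :=
  ⟨Set.univ ×ˢ (G : Set Plane), isOpen_univ.prod G.isOpen⟩

/-! ### Geometry -/

/-- Lipschitz open sets: near every boundary point the set is, in suitable orthonormal coordinates,
the region above the graph of a Lipschitz function. -/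
def IsLipschitzSet (G : Set Plane) : Prop :=
  ∀ x ∈ frontier G, ∃ (e : Plane ≃ₗᵢ[ℝ] Plane) (f : ℝ → ℝ) (L : ℝ≥0), LipschitzWith L f ∧
    ∀ᶠ y in 𝓝 x, (y ∈ G ↔ f (e y 0) < e y 1)

/-! ### Sobolev norms with parameter and spaces on the plane

Elements of `H^r(ℝ²)` are described by their Fourier transforms
`f(ξ) = ∫ exp(-i x·ξ) v(x) dx`. -/

/-- The square of the norm of `H^r(ℝ²)` with parameter `ω`:
`∫ (|ω|² + |ξ|²)^r |f(ξ)|² dξ`, for the element with Fourier transform `f`. -/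
def wnormSq (r : ℝ) (ω : ℂ) (f : Plane → ℂ) : ℝ≥0∞ :=
  ∫⁻ ξ, ENNReal.ofReal ((‖ω‖ ^ 2 + ‖ξ‖ ^ 2) ^ r) * ‖f ξ‖ₑ ^ 2

/-- `f` is the Fourier transform of an element `v` of
`H̃^r(A) = {v ∈ H^r(ℝ²) : supp v ⊆ closure A}`.  The distribution `v` acts on a test function `ψ` by
`(2π)⁻² ∫ f(ξ) (∫ exp(i x·ξ) ψ(x) dx) dξ`. -/
structure IsTildeHat (r : ℝ) (A : Set Plane) (f : Plane → ℂ) : Prop where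
  meas : AEStronglyMeasurable f volume
  finite : wnormSq r 1 f < ∞
  support : ∀ ψ : 𝓓((⊤ : Opens Plane), ℝ), Disjoint (tsupport ψ) (closure A) →
    ∫ ξ, f ξ * ∫ x, Complex.exp (Complex.I * (inner ℝ x ξ : ℝ)) * (ψ x : ℂ) = 0

/-- The square of the quotient norm with parameter `ω` on
`H^r(G) = H^r(ℝ²) / H̃^r(ℝ² ∖ closure G)`, for the class of the element with Fourier transform `f`:
the infimum of `‖f + v‖²` over `v ∈ H̃^r(ℝ² ∖ closure G)`. -/
def quotNormSq (r : ℝ) (ω : ℂ) (G : Set Plane) (f : Plane → ℂ) : ℝ≥0∞ :=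
  ⨅ (v : Plane → ℂ) (_ : IsTildeHat r (closure G)ᶜ v), wnormSq r ω (f + v)

/-! ### Space-time distributions and their Fourier-Laplace transforms

The transform of a distribution `u` is `û(ω, ξ) = ∫∫ exp(iωt - i x·ξ) u(t,x) dx dt`.
It is used on the line `Im ω = σ`, that is, `û(ξ₀ + iσ, ξ)` is the Fourier transform of
`exp(-σt) u` at `(ξ₀, ξ)`.  Functions `U` on `ℝ × ℝ²` below stand for
`U (ξ₀, ξ) = û(ξ₀ + iσ, ξ)`. -/

/-- The point `ω = ξ₀ + iσ` of the line `Im ω = σ`. -/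
def freq (σ ξ₀ : ℝ) : ℂ := (ξ₀ : ℂ) + Complex.I * (σ : ℂ)

/-- `∫∫ exp(-iωt + i x·ξ) φ(t,x) dx dt` for a test function `φ`. -/
def dualTransform (φ : SpaceTime → ℝ) (ω : ℂ) (ξ : Plane) : ℂ :=
  ∫ z : SpaceTime, Complex.exp (-Complex.I * ω * (z.1 : ℂ)
    + Complex.I * (inner ℝ z.2 ξ : ℝ)) * (φ z : ℂ)

/-- On the open set `Ω` the distribution `T` is given by the inverse Fourier-Laplace integral of
`U` along `Im ω = σ`: equivalently, `exp(-σt) T` is the restriction to `Ω` of the tempered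
distribution on `ℝ × ℝ²` whose Fourier transform is `U`. -/
def IsInverseLaplace (σ : ℝ) {Ω : Opens SpaceTime} (T : 𝓓'(Ω, ℝ)) (U : SpaceTime → ℂ) : Prop :=
  ∀ φ : 𝓓(Ω, ℝ), ((T φ : ℝ) : ℂ) =
    (((2 * Real.pi) ^ 3)⁻¹ : ℝ) * ∫ z : SpaceTime, U z * dualTransform φ (freq σ z.1) z.2

/-- The norm `‖u‖_{s,r,σ,*}` of the distribution with transform `U`:
`(∫_{Im ω = σ} |ω|^{2s} ‖û(ω)‖²_{r,ω} dω)^{1/2}`. -/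
def stNorm (σ s r : ℝ) (U : SpaceTime → ℂ) : ℝ≥0∞ :=
  (∫⁻ ξ₀ : ℝ, ENNReal.ofReal (‖freq σ ξ₀‖ ^ (2 * s)) *
    wnormSq r (freq σ ξ₀) (fun ξ => U (ξ₀, ξ))) ^ (1 / 2 : ℝ)

/-- The norm `‖f‖_{s,r,σ}` on `H^s_σ(ℝ⁺, H^r(G))`:
`(∫_{Im ω = σ} |ω|^{2s} ‖f̂(ω)‖²_{r,ω,G} dω)^{1/2}`, where `F (ξ₀, ·)` represents the class
`f̂(ξ₀ + iσ)` of `H^r(G) = H^r(ℝ²) / H̃^r(ℝ² ∖ closure G)`. -/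
def stQuotNorm (σ s r : ℝ) (G : Set Plane) (F : SpaceTime → ℂ) : ℝ≥0∞ :=
  (∫⁻ ξ₀ : ℝ, ENNReal.ofReal (‖freq σ ξ₀‖ ^ (2 * s)) *
    quotNormSq r (freq σ ξ₀) G (fun ξ => F (ξ₀, ξ))) ^ (1 / 2 : ℝ)

/-- The space `H^s_σ(ℝ⁺, H̃^r(G))` of real distributions on `ℝ × ℝ²` with support in
`[0,∞) × closure G` whose Fourier-Laplace transform `hat` on `Im ω = σ` (unique almost everywhere)
is a function of finite norm `‖·‖_{s,r,σ,*}`. -/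
structure HTilde (σ s r : ℝ) (G : Set Plane) where
  dist : 𝓓'(wholeST, ℝ)
  hat : SpaceTime → ℂ
  meas : AEStronglyMeasurable hat volume
  laplace : IsInverseLaplace σ dist hat
  support : ∀ φ : 𝓓(wholeST, ℝ), Disjoint (tsupport φ) (Set.Ici (0 : ℝ) ×ˢ closure G) →
    dist φ = 0
  finite : stNorm σ s r hat < ∞

/-- The space `H^s_σ(ℝ⁺, H^r(G))`.  As `H^r(G) = H^r(ℝ²) / H̃^r(ℝ² ∖ closure G)` consists of the
restrictions to `G` of elements of `H^r(ℝ²)`, its elements are real distributions on `ℝ × G` with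
support in `[0,∞) × G`; `hat (ξ₀, ·)` is, for almost all `ξ₀`, the Fourier transform of a
representative in `H^r(ℝ²)` of the value at `ω = ξ₀ + iσ` of the Fourier-Laplace transform. -/
structure HQuot (σ s r : ℝ) (G : Opens Plane) where
  dist : 𝓓'(cylinder G, ℝ)
  hat : SpaceTime → ℂ
  meas : AEStronglyMeasurable hat volume
  tempered : ∃ k : ℕ, Integrable (fun z => ((1 + ‖z‖) ^ k)⁻¹ * ‖hat z‖) volume
  slices : ∀ᵐ ξ₀ : ℝ, wnormSq r (freq σ ξ₀) (fun ξ => hat (ξ₀, ξ)) < ∞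
  laplace : IsInverseLaplace σ dist hat
  support : ∀ φ : 𝓓(cylinder G, ℝ), Disjoint (tsupport φ) (Set.Ici (0 : ℝ) ×ˢ Set.univ) →
    dist φ = 0
  finite : stQuotNorm σ s r G hat < ∞

/-- The set `H^s_σ(ℝ⁺, H̃^r(G))⁺` of nonnegative distributions. -/
def nonnegCone (σ s r : ℝ) (G : Set Plane) : Set (HTilde σ s r G) :=
  {u | ∀ φ : 𝓓(wholeST, ℝ), (∀ z, 0 ≤ φ z) → 0 ≤ u.dist φ}

/-- The dual pairing `⟨f, v⟩_σ` which extends `∫_0^∞ exp(-2σt) ∫_G f v dx dt`, written by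
Parseval's theorem as `(2π)⁻³ ∫ ⟨f̂(ξ₀ + iσ), v̂(ξ₀ + iσ)⟩ dξ₀`, where the inner pairing of
`H^{-r}(G)` and `H̃^r(G)` is evaluated on a representative of `f̂(ξ₀ + iσ)`.
It is real for real distributions. -/
def pairing (F V : SpaceTime → ℂ) : ℝ :=
  ((2 * Real.pi) ^ 3)⁻¹ *
    (∫ ξ₀ : ℝ, ∫ ξ : Plane, F (ξ₀, ξ) * (starRingEnd ℂ) (V (ξ₀, ξ))).re

/-! ### The Dirichlet-to-Neumann operator of the half space -/

/-- `Γ(ω, ξ) = √(ω²/c² - |ξ|²)`, with the branch of positive imaginary part (for `Im ω > 0`). -/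
def gammaSymbol (c : ℝ) (ω : ℂ) (ξ : Plane) : ℂ :=
  Complex.I * ((‖ξ‖ ^ 2 : ℝ) - (ω / c) ^ 2) ^ (1 / 2 : ℂ)

/-- The Fourier-Laplace transform of `S_σ u`, where `S_σ w|_Γ = -μ ∂w/∂ν` is the
Dirichlet-to-Neumann operator, from that of `u`: multiplication by `-iμΓ(ξ₀ + iσ, ξ)`.
It also represents the restriction `p_Q S_σ u` to `Q = ℝ × G`. -/
def dtn (μ c σ : ℝ) (U : SpaceTime → ℂ) : SpaceTime → ℂ :=
  fun z => -Complex.I * μ * gammaSymbol c (freq σ z.1) z.2 * U z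

/-! ### Discretisation -/

/-- A triangulation of `closure G` into finitely many closed triangles.  The triangles are the faces
with three vertices; two of them meet in a common face or not at all. -/
structure Triangulation (G : Set Plane) where
  complex : Geometry.SimplicialComplex ℝ Plane
  finite_faces : complex.faces.Finite
  pure : ∀ s ∈ complex.faces, ∃ t ∈ complex.faces, s ⊆ t ∧ t.card = 3
  space_eq : complex.space = closure G

/-- `V_t^p`: continuous piecewise polynomials of degree at most `p` in time on the grid
`t_n = nΔt`, vanishing for `t ≤ 0`.  The time mesh has `N ≤ ∞` intervals;
for finite `N` the functions vanish after the final time `NΔt`. -/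
def timeSpace (Δt : ℝ) (N : ℕ∞) (p : ℕ) : Set (ℝ → ℝ) :=
  {g | Continuous g ∧ (∀ t ≤ 0, g t = 0) ∧
    (∀ n : ℕ, ∃ P : Polynomial ℝ, P.natDegree ≤ p ∧
      ∀ t ∈ Set.Icc (n * Δt) ((n + 1) * Δt), g t = P.eval t) ∧
    (∀ M : ℕ, N = M → ∀ t, M * Δt ≤ t → g t = 0)}

/-- `Ṽ_h^q(G)`: continuous piecewise polynomials of degree at most `q` on the triangulation which
vanish on the boundary of `G`, extended by zero outside `G`. -/
def spaceSpace {G : Set Plane} (𝒯 : Triangulation G) (q : ℕ) : Set (Plane → ℝ) :=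
  {f | Continuous f ∧ (∀ x ∉ G, f x = 0) ∧
    ∀ s ∈ 𝒯.complex.faces, s.card = 3 → ∃ P : MvPolynomial (Fin 2) ℝ, P.totalDegree ≤ q ∧
      ∀ x ∈ convexHull ℝ (s : Set Plane), f x = MvPolynomial.eval (fun i => x i) P}

/-- The algebraic tensor product `V_t^p ⊗ Ṽ_h^q`, as functions on space-time. -/
def tensorSpace {G : Set Plane} (𝒯 : Triangulation G) (Δt : ℝ) (N : ℕ∞) (p q : ℕ) :
    Submodule ℝ (SpaceTime → ℝ) :=
  Submodule.span ℝ {F | ∃ g ∈ timeSpace Δt N p, ∃ f ∈ spaceSpace 𝒯 q,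
    F = fun z => g z.1 * f z.2}

/-- `K̃⁺_{t,h}`: the nonnegative functions in `V_t^p ⊗ Ṽ_h^q`, as a subset of
`H^{1/2}_σ(ℝ⁺, H̃^{1/2}(G))`. -/
def discreteCone (σ : ℝ) {G : Set Plane} (𝒯 : Triangulation G) (Δt : ℝ) (N : ℕ∞) (p q : ℕ) :
    Set (HTilde σ (1 / 2) (1 / 2) G) :=
  {w | ∃ F ∈ tensorSpace 𝒯 Δt N p q, (∀ z, 0 ≤ F z) ∧
    ∀ φ : 𝓓(wholeST, ℝ), w.dist φ = ∫ z : SpaceTime, F z * φ z}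

/-- `u` solves the variational inequality on the set `K` with data `h`:
`u ∈ K` and `⟨p_Q S_σ u, v - u⟩_σ ≥ ⟨h, v - u⟩_σ` for all `v ∈ K`. -/
def SolvesVI {σ : ℝ} (μ c : ℝ) {G : Opens Plane} (h : HQuot σ (3 / 2) (-1 / 2) G)
    (K : Set (HTilde σ (1 / 2) (1 / 2) (G : Set Plane)))
    (u : HTilde σ (1 / 2) (1 / 2) (G : Set Plane)) : Prop :=
  u ∈ K ∧ ∀ v ∈ K, pairing h.hat (v.hat - u.hat) ≤ pairing (dtn μ c σ u.hat) (v.hat - u.hat)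

end FlatContact

end

/-! The estimate is of Falk type. Write `e = u - uh`. The discrete cone lies in the continuous one,
so `uh` is admissible in the inequality for `u`, and any discrete `φ` is admissible in the
inequality for `uh`. Adding the two gives `⟨S e, e⟩ ≤ ⟨S e, u - φ⟩ + ⟨h - S u, u - φ⟩`.

In Fourier variables `S` is multiplication by a symbol whose real part is at least `κ |ω|⁻¹ (|ω|² +
|ξ|²)^{1/2}` (`exists_dtnSymbol_re_ge`) and whose modulus is at most `M (|ω|² + |ξ|²)^{1/2}`
(`exists_norm_dtnSymbol_le`). The first bound makes the left side control `‖e‖²` in the norm `(-1/2,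
1/2)`. The second bounds `⟨S e, u - φ⟩` by the norm `(-1/2, 1/2)` of `e` times the norm `(1/2, 1/2)`
of `u - φ`, and Young's inequality absorbs `e` (`sq_le_of_coercive`). Only `κ` and `M` enter the
constant.

The residual term must be bounded by a quotient norm on `G`, although the pairing is computed from a
representative on the whole plane. This requires the pairing of `H̃^{-1/2}(ℝ² ∖ closure G)` with
`H̃^{1/2}(G)` to vanish, and it is here that the geometry enters: near a boundary point of a
Lipschitz set, a function supported in `closure G` can be shifted into `G` and mollified, so that it
becomes a limit of test functions in `G` (`integral_mul_fourierInv_eq_zero_of_translate`).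
Multiplication by Schwartz functions preserves `H^{1/2}`, which allows localisation.

The support condition is imposed on space-time distributions, whereas orthogonality is needed at
almost every fixed frequency. Product test functions give it for one spatial test function at a
time, and separability of `L²` makes the exceptional null set independent of the test function
(`HTilde.ae_forall_integral_slice_eq_zero`). -/

namespace FlatContact

open scoped FourierTransform SchwartzMap ContDiff

/-! ### Fourier inversion in `L²`, with frequencies normalised as in the Laplace transform. -/

section Fourier

variable {E : Type*} [NormedAddCommGroup E] [InnerProductSpace ℝ E] [FiniteDimensional ℝ E]
  [MeasurableSpace E] [BorelSpace E]

/-- The Schwartz function given by a real test function. -/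
noncomputable def schwartzOfReal (φ : E → ℝ) (hφ : ContDiff ℝ ∞ φ) (hs : HasCompactSupport φ) :
    𝓢(E, ℂ) :=
  (hs.comp_left (g := fun x : ℝ => (x : ℂ)) (by simp)).toSchwartzMap
    (Complex.ofRealCLM.contDiff.comp hφ)

omit [FiniteDimensional ℝ E] [MeasurableSpace E] [BorelSpace E] in
theorem schwartzOfReal_coe (φ : E → ℝ) (hφ : ContDiff ℝ ∞ φ) (hs : HasCompactSupport φ) :
    ⇑(schwartzOfReal φ hφ hs) = fun x => (φ x : ℂ) := rfl

/-- The inverse Fourier transform of a square integrable function, characterised by duality. -/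
theorem exists_inverse_fourier_of_memLp_two {g : E → ℂ} (hg : MemLp g 2) :
    ∃ w : E → ℂ, MemLp w 2 ∧ (∀ ψ : 𝓢(E, ℂ), ∫ η, g η * (𝓕⁻ ψ) η = ∫ x, w x * ψ x) ∧
      (Integrable w → g =ᵐ[volume] 𝓕 w) := by
  set G : Lp ℂ 2 (volume : Measure E) := hg.toLp g
  set W : Lp ℂ 2 (volume : Measure E) := 𝓕⁻ G
  have hG : (G : E → ℂ) =ᵐ[volume] g := hg.coeFn_toLp
  have hFW : 𝓕 W = G := FourierTransform.fourier_fourierInv_eq G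
  refine ⟨W, Lp.memLp W, fun ψ => ?_, fun hW => ?_⟩
  · have h := congrArg (fun T : 𝓢'(E, ℂ) => T ψ) (Lp.fourierInv_toTemperedDistribution_eq G)
    simp only [TemperedDistribution.fourierInv_apply, Lp.toTemperedDistribution_apply,
      smul_eq_mul] at h
    rw [show (∫ x, (W : E → ℂ) x * ψ x) = ∫ x, ψ x * (W : E → ℂ) x by simp_rw [mul_comm], ← h]
    refine integral_congr_ae ?_
    filter_upwards [hG] with x hx
    rw [hx, mul_comm]
  · have hcont : Continuous (𝓕 (W : E → ℂ)) :=
      VectorFourier.fourierIntegral_continuous Real.continuous_fourierChar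
        (show Continuous fun p : E × E => inner ℝ p.1 p.2 by fun_prop) hW
    -- The `L²` transform and the Fourier integral of `W` are compared as distributions: both move
    -- onto the test function.
    refine ae_eq_of_integral_contDiff_smul_eq (hg.locallyIntegrable (by norm_num))
      hcont.locallyIntegrable fun φ hφ hφs => ?_
    set Φ : 𝓢(E, ℂ) := schwartzOfReal φ hφ hφs with hΦ
    have hΦa : ∀ x, Φ x = φ x := fun x => rfl
    have h := congrArg (fun T : 𝓢'(E, ℂ) => T Φ) (Lp.fourier_toTemperedDistribution_eq W)
    simp only [TemperedDistribution.fourier_apply, Lp.toTemperedDistribution_apply, hFW,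
      smul_eq_mul] at h
    have h2 := VectorFourier.integral_fourierIntegral_smul_eq_flip (μ := volume) (ν := volume)
      (L := innerₗ E) (f := (W : E → ℂ)) (g := Φ) Real.continuous_fourierChar
        (show Continuous fun p : E × E => inner ℝ p.1 p.2 by fun_prop) hW Φ.integrable
    rw [flip_innerₗ] at h2
    calc ∫ x, φ x • g x = ∫ x, Φ x * (G : E → ℂ) x := by
          refine integral_congr_ae ?_
          filter_upwards [hG] with x hx
          rw [hx, hΦa, Complex.real_smul]
      _ = ∫ x, (W : E → ℂ) x * (𝓕 Φ) x := by rw [← h]; simp_rw [mul_comm]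
      _ = ∫ x, φ x • 𝓕 (W : E → ℂ) x := by
          rw [SchwartzMap.fourier_coe]
          refine h2.symm.trans ?_
          refine integral_congr_ae (Filter.Eventually.of_forall fun x => ?_)
          simp only [Complex.real_smul, hΦa, smul_eq_mul]
          rw [mul_comm]; rfl

/-- `∫ exp(i x·ξ) ψ(x) dx`. -/
noncomputable def angularInv (ψ : E → ℂ) (ξ : E) : ℂ :=
  ∫ x, Complex.exp (Complex.I * (inner ℝ x ξ : ℝ)) * ψ x

/-- Mathlib puts `2π` in the exponent of the Fourier kernel; the dilation by `2π` translates between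
the two conventions. -/
theorem angularInv_eq (ψ : E → ℂ) (ξ : E) :
    angularInv ψ ξ = 𝓕⁻ ψ ((2 * Real.pi)⁻¹ • ξ) := by
  rw [angularInv, Real.fourierInv_eq]
  congr 1
  ext x
  rw [Circle.smul_def, Real.fourierChar_apply, smul_eq_mul, inner_smul_right]
  congr 2
  push_cast
  field_simp

theorem angularInv_smul (ψ : E → ℂ) (η : E) :
    angularInv ψ ((2 * Real.pi) • η) = 𝓕⁻ ψ η := by
  rw [angularInv_eq, smul_smul, inv_mul_cancel₀ (by positivity), one_smul]

theorem integral_comp_two_pi_smul (f : E → ℂ) :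
    ∫ η, f ((2 * Real.pi) • η) =
      (((2 * Real.pi) ^ Module.finrank ℝ E)⁻¹ : ℝ) * ∫ ξ, f ξ := by
  rw [Measure.integral_comp_smul, abs_of_pos (by positivity), Complex.real_smul]

theorem memLp_comp_two_pi_smul {g : E → ℂ} (hg : MemLp g 2) :
    MemLp (fun η => g ((2 * Real.pi) • η)) 2 := by
  refine (memLp_map_measure_iff (μ := volume) (f := fun η : E => (2 * Real.pi) • η)
    (g := g) (p := 2) ?_ (by fun_prop)).1 ?_
  · rw [Measure.map_addHaar_smul _ (by positivity)]
    exact hg.1.smul_measure _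
  · rw [Measure.map_addHaar_smul _ (by positivity)]
    exact hg.smul_measure ENNReal.ofReal_ne_top

theorem ae_comp_smul {p : E → Prop} {c : ℝ} (hc : c ≠ 0) (h : ∀ᵐ η : E, p η) :
    ∀ᵐ ξ : E, p (c • ξ) := by
  have hq : Measure.QuasiMeasurePreserving (fun η : E => c • η) volume volume :=
    ⟨measurable_const_smul _, by
      rw [Measure.map_addHaar_smul _ hc]
      exact Measure.smul_absolutelyContinuous⟩
  exact hq.ae h

/-- A square integrable `g` is, in the sense of distributions, the Fourier transform (in angular
frequency) of some square integrable `w`. -/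
theorem exists_angular_inverse {g : E → ℂ} (hg : MemLp g 2) :
    ∃ w : E → ℂ, MemLp w 2 ∧
      (∀ ψ : 𝓢(E, ℂ), ∫ ξ, g ξ * angularInv ψ ξ = 0 → ∫ x, w x * ψ x = 0) ∧
      (Integrable w → ∀ᵐ η, g ((2 * Real.pi) • η) = 𝓕 w η) := by
  obtain ⟨w, hw, hψ, hF⟩ := exists_inverse_fourier_of_memLp_two (memLp_comp_two_pi_smul hg)
  refine ⟨w, hw, fun ψ h0 => ?_, hF⟩
  rw [← hψ]
  have h1 : ∀ η, (𝓕⁻ ψ) η = angularInv ψ ((2 * Real.pi) • η) := fun η => by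
    rw [angularInv_smul, SchwartzMap.fourierInv_coe]
  simp_rw [h1]
  rw [integral_comp_two_pi_smul (fun ξ => g ξ * angularInv ψ ξ), h0, mul_zero]

/-- A square integrable function vanishes almost everywhere if its integrals against the Fourier
transforms of all test functions vanish. -/
theorem ae_eq_zero_of_integral_angularInv {g : E → ℂ} (hg : MemLp g 2)
    (h : ∀ φ : E → ℝ, ContDiff ℝ ∞ φ → HasCompactSupport φ →
      ∫ ξ, g ξ * angularInv (fun x => (φ x : ℂ)) ξ = 0) : g =ᵐ[volume] 0 := by
  obtain ⟨w, hw, hψ, hF⟩ := exists_angular_inverse hg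
  have hw0 : ∀ᵐ x, w x = 0 := by
    refine ae_eq_zero_of_integral_contDiff_smul_eq_zero (hw.locallyIntegrable (by norm_num))
      fun φ hφ hs => ?_
    have := hψ (schwartzOfReal φ hφ hs) (h φ hφ hs)
    simpa [schwartzOfReal_coe, mul_comm] using this
  -- Being null, `w` is integrable, so `g` is given by its Fourier integral, which is zero.
  have hwi : Integrable w := (integrable_zero E ℂ volume).congr
    (hw0.mono fun x hx => hx.symm)
  have h0 : 𝓕 w = 0 := by
    ext η
    rw [Real.fourier_eq]
    rw [integral_congr_ae (g := fun _ => 0) (hw0.mono fun x hx => by simp [hx])]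
    simp
  have h1 := ae_comp_smul (c := (2 * Real.pi)⁻¹) (by positivity) (hF hwi)
  filter_upwards [h1] with ξ hξ
  rw [smul_smul, mul_inv_cancel₀ (by positivity), one_smul, h0] at hξ
  exact hξ

end Fourier

end FlatContact

/-! ### Cauchy-Schwarz inequalities and duality of weighted `L²` spaces. -/

namespace FlatContact

open scoped FourierTransform SchwartzMap ContDiff

theorem add_sq_le_four_mul (a b : ℝ≥0∞) : (a + b) ^ 2 ≤ 4 * (a ^ 2 + b ^ 2) := by
  have h : a + b ≤ 2 * max a b := by
    rw [two_mul]; exact add_le_add (le_max_left _ _) (le_max_right _ _)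
  refine (pow_le_pow_left' h 2).trans ?_
  rw [mul_pow]
  norm_num
  gcongr
  rcases max_choice a b with h | h <;> rw [h]
  · exact le_self_add
  · exact le_add_self

section CauchySchwarz

variable {α : Type*} [MeasurableSpace α] {μ : Measure α}

/-- The Cauchy-Schwarz inequality for the lower Lebesgue integral. -/
theorem lintegral_mul_sq_le {f g : α → ℝ≥0∞} (hf : AEMeasurable f μ) (hg : AEMeasurable g μ) :
    (∫⁻ x, f x * g x ∂μ) ^ 2 ≤ (∫⁻ x, f x ^ 2 ∂μ) * ∫⁻ x, g x ^ 2 ∂μ := by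
  have h := ENNReal.lintegral_mul_le_Lp_mul_Lq μ Real.HolderConjugate.two_two hf hg
  have h2 : (∫⁻ x, f x * g x ∂μ) ^ 2 ≤
      ((∫⁻ x, f x ^ (2 : ℝ) ∂μ) ^ (1 / 2 : ℝ) * (∫⁻ x, g x ^ (2 : ℝ) ∂μ) ^ (1 / 2 : ℝ)) ^ 2 := by
    gcongr
    exact h
  refine h2.trans_eq ?_
  rw [mul_pow, ← ENNReal.rpow_two, ← ENNReal.rpow_two, ← ENNReal.rpow_mul, ← ENNReal.rpow_mul]
  norm_num

/-- The Cauchy-Schwarz inequality with a weight. -/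
theorem lintegral_weight_mul_sq_le {k u : α → ℝ≥0∞} (hk : AEMeasurable k μ)
    (hu : AEMeasurable u μ) :
    (∫⁻ x, k x * u x ∂μ) ^ 2 ≤ (∫⁻ x, k x ∂μ) * ∫⁻ x, k x * u x ^ 2 ∂μ := by
  have hs : ∀ a : ℝ≥0∞, a ^ (1 / 2 : ℝ) * a ^ (1 / 2 : ℝ) = a := fun a => by
    rw [← ENNReal.rpow_add_of_nonneg _ _ (by norm_num) (by norm_num)]; norm_num
  have h := lintegral_mul_sq_le (μ := μ) (f := fun x => k x ^ (1 / 2 : ℝ))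
    (g := fun x => k x ^ (1 / 2 : ℝ) * u x) (hk.pow_const _) ((hk.pow_const _).mul hu)
  have hs2 : ∀ a : ℝ≥0∞, (a ^ (1 / 2 : ℝ)) ^ 2 = a := fun a => by rw [pow_two, hs]
  simpa only [← mul_assoc, hs, mul_pow, hs2] using h

/-- Two functions whose squares are integrable with reciprocal weights have integrable product. -/
theorem integrable_mul_of_weight {k : α → ℝ≥0∞} (hk : AEMeasurable k μ) (hk0 : ∀ x, k x ≠ 0)
    (hkt : ∀ x, k x ≠ ⊤) {f g : α → ℂ} (hfm : AEStronglyMeasurable f μ)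
    (hgm : AEStronglyMeasurable g μ) (hf : ∫⁻ x, (k x)⁻¹ * ‖f x‖ₑ ^ 2 ∂μ < ⊤)
    (hg : ∫⁻ x, k x * ‖g x‖ₑ ^ 2 ∂μ < ⊤) : Integrable (fun x => f x * g x) μ := by
  refine ⟨hfm.mul hgm, ?_⟩
  have hle : ∀ x, ‖f x * g x‖ₑ ≤ (k x)⁻¹ * ‖f x‖ₑ ^ 2 + k x * ‖g x‖ₑ ^ 2 := fun x => by
    have h1 : ‖f x * g x‖ₑ = k x * (((k x)⁻¹ * ‖f x‖ₑ) * ‖g x‖ₑ) := by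
      rw [enorm_mul, ← mul_assoc, ← mul_assoc, ENNReal.mul_inv_cancel (hk0 x) (hkt x), one_mul]
    rw [h1]
    rcases le_total ((k x)⁻¹ * ‖f x‖ₑ) ‖g x‖ₑ with h | h
    · refine le_add_left ?_
      rw [pow_two]
      gcongr
    · refine le_add_right ?_
      calc k x * (((k x)⁻¹ * ‖f x‖ₑ) * ‖g x‖ₑ)
          ≤ k x * (((k x)⁻¹ * ‖f x‖ₑ) * ((k x)⁻¹ * ‖f x‖ₑ)) := by gcongr
        _ = (k x * (k x)⁻¹) * ((k x)⁻¹ * ‖f x‖ₑ ^ 2) := by ring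
        _ = _ := by rw [ENNReal.mul_inv_cancel (hk0 x) (hkt x), one_mul]
  refine (lintegral_mono hle).trans_lt ?_
  rw [lintegral_add_left' (by exact hk.inv.mul (hfm.enorm.pow_const 2))]
  exact ENNReal.add_lt_top.2 ⟨hf, hg⟩

end CauchySchwarz

/-! ### Schwartz functions as multipliers of `H^{1/2}`. -/

section Multiplier

variable {E : Type*} [NormedAddCommGroup E] [InnerProductSpace ℝ E] [FiniteDimensional ℝ E]
  [MeasurableSpace E] [BorelSpace E]

/-- The function `W` is the Fourier transform of an element of `H^{1/2}`. -/
def FiniteHalf (W : E → ℂ) : Prop := ∫⁻ ζ, (1 + ‖ζ‖ₑ) * ‖W ζ‖ₑ ^ 2 < ⊤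

/-- The function `v` is the Fourier transform of an element of `H^{-1/2}`. -/
def FiniteNegHalf (v : E → ℂ) : Prop := ∫⁻ ζ, (1 + ‖ζ‖ₑ)⁻¹ * ‖v ζ‖ₑ ^ 2 < ⊤

theorem FiniteNegHalf.integrable_mul {v W : E → ℂ} (hv : FiniteNegHalf v)
    (hvm : AEStronglyMeasurable v) (hW : FiniteHalf W) (hWm : AEStronglyMeasurable W) :
    Integrable (fun ζ => v ζ * W ζ) :=
  integrable_mul_of_weight (k := fun ζ : E => 1 + ‖ζ‖ₑ) (by fun_prop) (fun _ => by simp)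
    (fun _ => by simp) hvm hWm hv hW

theorem continuous_fourierInv {w : E → ℂ} (hw : Integrable w) : Continuous (𝓕⁻ w) := by
  have : Continuous (𝓕 w) := VectorFourier.fourierIntegral_continuous Real.continuous_fourierChar
    (show Continuous fun p : E × E => inner ℝ p.1 p.2 by fun_prop) hw
  have h2 : 𝓕⁻ w = fun η => 𝓕 w (-η) := by
    ext η; exact Real.fourierInv_eq_fourier_neg w η
  rw [h2]
  exact this.comp continuous_neg

/-- A Schwartz function has finite `H^{1/2}` weight. -/
theorem finiteHalf_schwartz (a : 𝓢(E, ℂ)) : FiniteHalf a := by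
  obtain ⟨C, hC0, hC⟩ : ∃ C : ℝ, 0 ≤ C ∧ ∀ x, (1 + ‖x‖) * ‖a x‖ ≤ C := by
    obtain ⟨C0, h0⟩ := a.decay 0 0
    obtain ⟨C1, h1⟩ := a.decay 1 0
    refine ⟨C0 + C1, by linarith [h0.1, h1.1], fun x => ?_⟩
    have e0 := h0.2 x
    have e1 := h1.2 x
    simp only [pow_zero, one_mul, norm_iteratedFDeriv_zero, pow_one] at e0 e1
    linarith
  have hint := a.integrable (μ := volume)
  have h2 : Integrable (fun x => (1 + ‖x‖) * ‖a x‖ ^ 2) := by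
    refine (hint.norm.const_mul C).mono' (by fun_prop) (Filter.Eventually.of_forall fun x => ?_)
    rw [Real.norm_of_nonneg (by positivity), pow_two, ← mul_assoc]
    gcongr
    exact hC x
  have h3 := h2.2
  rw [HasFiniteIntegral] at h3
  refine lt_of_le_of_lt (lintegral_mono fun x => ?_) h3
  rw [Real.enorm_of_nonneg (by positivity), ENNReal.ofReal_mul (by positivity),
    ENNReal.ofReal_add (by norm_num) (norm_nonneg _), ENNReal.ofReal_pow (norm_nonneg _)]
  simp

/-- Write `χ` as the Fourier transform of `𝓕⁻ χ` and move that transform to the other factor; the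
modulation by `ζ` becomes a translation, leaving a convolution. -/
theorem fourierInv_schwartz_mul (χ : 𝓢(E, ℂ)) {w : E → ℂ} (hw : Integrable w) (ζ : E) :
    𝓕⁻ (fun x => χ x * w x) ζ = ∫ η, (𝓕⁻ χ : 𝓢(E, ℂ)) η * 𝓕⁻ w (ζ - η) := by
  have hwe : Integrable (fun x => Real.fourierChar (inner ℝ x ζ) • w x) := by
    have := (Real.fourierIntegral_convergent_iff (f := w) (-ζ)).2 hw
    simpa using this
  have h2 := VectorFourier.integral_fourierIntegral_smul_eq_flip (μ := volume) (ν := volume)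
      (L := innerₗ E) (f := ⇑(𝓕⁻ χ : 𝓢(E, ℂ))) (g := fun x => Real.fourierChar (inner ℝ x ζ) • w x)
      Real.continuous_fourierChar
      (show Continuous fun p : E × E => inner ℝ p.1 p.2 by fun_prop) (𝓕⁻ χ : 𝓢(E, ℂ)).integrable hwe
  rw [flip_innerₗ] at h2
  have h3 : VectorFourier.fourierIntegral Real.fourierChar volume (innerₗ E) ⇑(𝓕⁻ χ : 𝓢(E, ℂ)) = χ := by
    change 𝓕 ⇑(𝓕⁻ χ : 𝓢(E, ℂ)) = χ
    rw [← SchwartzMap.fourier_coe, FourierTransform.fourier_fourierInv_eq]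
  rw [h3] at h2
  rw [Real.fourierInv_eq]
  calc ∫ x, Real.fourierChar (inner ℝ x ζ) • (χ x * w x)
      = ∫ x, χ x • Real.fourierChar (inner ℝ x ζ) • w x := by
        congr 1; ext x; simp only [Circle.smul_def, smul_eq_mul]; ring
    _ = _ := h2
    _ = _ := by
        congr 1; ext η
        rw [smul_eq_mul]
        congr 1
        rw [Real.fourierInv_eq]
        change ∫ x, Real.fourierChar (-(inner ℝ x η)) • _ = _
        congr 1; ext x
        rw [smul_smul, ← AddChar.map_add_eq_mul, inner_sub_right, neg_add_eq_sub]

/-- Multiplication by a Schwartz function preserves `H^{1/2}`. -/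
theorem FiniteHalf.schwartz_mul (χ : 𝓢(E, ℂ)) {w : E → ℂ} (hw : Integrable w)
    (hW : FiniteHalf (𝓕⁻ w)) : FiniteHalf (𝓕⁻ fun x => χ x * w x) := by
  set k : E → ℂ := ⇑(𝓕⁻ χ : 𝓢(E, ℂ)) with hk
  set W : E → ℂ := 𝓕⁻ w with hWdef
  have hkm : Measurable (fun η => ‖k η‖ₑ) := (𝓕⁻ χ : 𝓢(E, ℂ)).continuous.enorm.measurable
  have hWm : Measurable (fun η => ‖W η‖ₑ) := (continuous_fourierInv hw).enorm.measurable
  have hk1 : ∫⁻ η, ‖k η‖ₑ < ⊤ := (𝓕⁻ χ : 𝓢(E, ℂ)).integrable.2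
  have hk2 : ∫⁻ η, ‖k η‖ₑ * (1 + ‖η‖ₑ) < ⊤ := by
    have h1 := ((𝓕⁻ χ : 𝓢(E, ℂ)).integrable (μ := volume)).norm.add
      ((𝓕⁻ χ : 𝓢(E, ℂ)).integrable_pow_mul volume 1)
    refine lt_of_le_of_lt (lintegral_mono fun x => ?_) h1.2
    rw [Pi.add_apply, Real.enorm_of_nonneg (by positivity), ENNReal.ofReal_add (by positivity)
      (by positivity), ENNReal.ofReal_mul (by positivity)]
    simp only [pow_one, ofReal_norm, hk]
    rw [mul_add, mul_one, mul_comm ‖x‖ₑ]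
  -- Cauchy-Schwarz with weight `|k|` keeps one integrable factor `k` under the integral, as in
  -- Young's convolution inequality.
  have hpt : ∀ ζ, ‖𝓕⁻ (fun x => χ x * w x) ζ‖ₑ ^ 2 ≤
      (∫⁻ η, ‖k η‖ₑ) * ∫⁻ η, ‖k η‖ₑ * ‖W (ζ - η)‖ₑ ^ 2 := fun ζ => by
    rw [fourierInv_schwartz_mul χ hw]
    calc _ ≤ (∫⁻ η, ‖k η‖ₑ * ‖W (ζ - η)‖ₑ) ^ 2 := by
          gcongr
          refine (enorm_integral_le_lintegral_enorm _).trans_eq ?_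
          simp [enorm_mul, hk, hWdef]
      _ ≤ _ := lintegral_weight_mul_sq_le hkm.aemeasurable
          (hWm.comp (measurable_const.sub measurable_id)).aemeasurable
  have hmeas : Measurable (Function.uncurry fun (ζ η : E) =>
      (‖k η‖ₑ * (1 + ‖η‖ₑ)) * ((1 + ‖ζ - η‖ₑ) * ‖W (ζ - η)‖ₑ ^ 2)) := by
    have h1 : Measurable (fun p : E × E => ‖k p.2‖ₑ) := hkm.comp measurable_snd
    have h2 : Measurable (fun p : E × E => ‖W (p.1 - p.2)‖ₑ) :=
      hWm.comp (measurable_fst.sub measurable_snd)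
    have h3 : Measurable (fun p : E × E => ‖p.1 - p.2‖ₑ) := by fun_prop
    have h4 : Measurable (fun p : E × E => ‖p.2‖ₑ) := by fun_prop
    exact (h1.mul (measurable_const.add h4)).mul
      ((measurable_const.add h3).mul (h2.pow_const 2))
  calc ∫⁻ ζ, (1 + ‖ζ‖ₑ) * ‖𝓕⁻ (fun x => χ x * w x) ζ‖ₑ ^ 2
      ≤ ∫⁻ ζ, (∫⁻ η, ‖k η‖ₑ) *
          ∫⁻ η, (‖k η‖ₑ * (1 + ‖η‖ₑ)) * ((1 + ‖ζ - η‖ₑ) * ‖W (ζ - η)‖ₑ ^ 2) := by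
        refine lintegral_mono fun ζ => ?_
        refine (mul_le_mul_right (hpt ζ) _).trans ?_
        rw [mul_left_comm, ← lintegral_const_mul' _ _ (by simp)]
        refine mul_le_mul_right (lintegral_mono fun η => ?_) _
        -- Peetre's inequality: the weight is submultiplicative, so it is shared between `k` and
        -- `W`. After Tonelli, translation invariance decouples the two integrals.
        have h1 : (1 + ‖ζ‖ₑ) ≤ (1 + ‖η‖ₑ) * (1 + ‖ζ - η‖ₑ) := by
          have : ‖ζ‖ₑ ≤ ‖η‖ₑ + ‖ζ - η‖ₑ := by
            simpa using enorm_add_le η (ζ - η)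
          calc 1 + ‖ζ‖ₑ ≤ 1 + (‖η‖ₑ + ‖ζ - η‖ₑ) := by gcongr
            _ ≤ 1 + (‖η‖ₑ + ‖ζ - η‖ₑ) + ‖η‖ₑ * ‖ζ - η‖ₑ := le_self_add
            _ = _ := by ring
        calc (1 + ‖ζ‖ₑ) * (‖k η‖ₑ * ‖W (ζ - η)‖ₑ ^ 2)
            ≤ ((1 + ‖η‖ₑ) * (1 + ‖ζ - η‖ₑ)) * (‖k η‖ₑ * ‖W (ζ - η)‖ₑ ^ 2) := by gcongr
          _ = _ := by ring
    _ = (∫⁻ η, ‖k η‖ₑ) * ∫⁻ η, ∫⁻ ζ,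
          (‖k η‖ₑ * (1 + ‖η‖ₑ)) * ((1 + ‖ζ - η‖ₑ) * ‖W (ζ - η)‖ₑ ^ 2) := by
        rw [lintegral_const_mul' _ _ hk1.ne, lintegral_lintegral_swap hmeas.aemeasurable]
    _ = (∫⁻ η, ‖k η‖ₑ) * ((∫⁻ η, ‖k η‖ₑ * (1 + ‖η‖ₑ)) *
          ∫⁻ ζ, (1 + ‖ζ‖ₑ) * ‖W ζ‖ₑ ^ 2) := by
        congr 1
        rw [← lintegral_mul_const' _ _ hW.ne]
        congr 1; ext η
        rw [lintegral_const_mul' _ _ (by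
          exact ENNReal.mul_ne_top (by simp) (by simp))]
        congr 1
        exact lintegral_sub_right_eq_self (fun ζ => (1 + ‖ζ‖ₑ) * ‖W ζ‖ₑ ^ 2) η
    _ < ⊤ := ENNReal.mul_lt_top hk1 (ENNReal.mul_lt_top hk2 hW)

end Multiplier

end FlatContact

namespace FlatContact

open scoped FourierTransform SchwartzMap ContDiff Convolution

/-! ### Orthogonality by inward translation, mollification and localisation. -/

section Localization

variable {E : Type*} [NormedAddCommGroup E] [InnerProductSpace ℝ E] [FiniteDimensional ℝ E]
  [MeasurableSpace E] [BorelSpace E]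

/-- A distribution vanishing on real test functions supported in `O` vanishes on the complex ones. -/
theorem integral_mul_fourierInv_complex {v : E → ℂ} (hvm : AEStronglyMeasurable v)
    (hv : FiniteNegHalf v) {O : Set E}
    (hO : ∀ φ : E → ℝ, ContDiff ℝ ∞ φ → HasCompactSupport φ → tsupport φ ⊆ O →
      ∫ η, v η * 𝓕⁻ (fun x => (φ x : ℂ)) η = 0)
    {ψ : E → ℂ} (hψ : ContDiff ℝ ∞ ψ) (hs : HasCompactSupport ψ) (hsO : tsupport ψ ⊆ O) :
    ∫ η, v η * 𝓕⁻ ψ η = 0 := by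
  have hre : ContDiff ℝ ∞ (fun x => (ψ x).re) := Complex.reCLM.contDiff.comp hψ
  have him : ContDiff ℝ ∞ (fun x => (ψ x).im) := Complex.imCLM.contDiff.comp hψ
  have hsre : HasCompactSupport (fun x => (ψ x).re) := hs.comp_left (g := Complex.re) rfl
  have hsim : HasCompactSupport (fun x => (ψ x).im) := hs.comp_left (g := Complex.im) rfl
  have hb : ∀ g : ℂ → ℝ, g 0 = 0 → tsupport (fun x => g (ψ x)) ⊆ O := fun g hg =>
    (closure_mono (Function.support_comp_subset hg ψ)).trans hsO
  set a : 𝓢(E, ℂ) := schwartzOfReal _ hre hsre with ha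
  set b : 𝓢(E, ℂ) := schwartzOfReal _ him hsim with hb'
  have hψab : ψ = ⇑(a + Complex.I • b) := by
    ext x
    simp only [add_apply, smul_apply, ha, hb', schwartzOfReal_coe,
      smul_eq_mul]
    rw [mul_comm]
    exact (Complex.re_add_im (ψ x)).symm
  have hF : 𝓕⁻ ψ = fun η => (𝓕⁻ a : 𝓢(E, ℂ)) η + Complex.I * (𝓕⁻ b : 𝓢(E, ℂ)) η := by
    rw [hψab, ← SchwartzMap.fourierInv_coe, FourierTransform.fourierInv_add,
      FourierTransform.fourierInv_smul]
    rfl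
  have hint : ∀ c : 𝓢(E, ℂ), Integrable fun η => v η * (𝓕⁻ c : 𝓢(E, ℂ)) η := fun c =>
    hv.integrable_mul hvm (finiteHalf_schwartz _) (𝓕⁻ c : 𝓢(E, ℂ)).continuous.aestronglyMeasurable
  have h1 : ∫ η, v η * (𝓕⁻ a : 𝓢(E, ℂ)) η = 0 := by
    rw [SchwartzMap.fourierInv_coe]
    exact hO _ hre hsre (hb Complex.re rfl)
  have h2 : ∫ η, v η * (𝓕⁻ b : 𝓢(E, ℂ)) η = 0 := by
    rw [SchwartzMap.fourierInv_coe]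
    exact hO _ him hsim (hb Complex.im rfl)
  calc ∫ η, v η * 𝓕⁻ ψ η
      = ∫ η, (v η * (𝓕⁻ a : 𝓢(E, ℂ)) η + Complex.I * (v η * (𝓕⁻ b : 𝓢(E, ℂ)) η)) := by
        congr 1; ext η; rw [hF]; ring
    _ = 0 := by
        rw [integral_add (hint a) ((hint b).const_mul _), integral_const_mul, h1, h2]
        simp

/-- The bump is nonnegative with total mass one. The bound supplies the domination in the
mollification limit. -/
theorem norm_fourierInv_normed_le (ρ : ContDiffBump (0 : E)) (η : E) :
    ‖𝓕⁻ (fun x => (ρ.normed volume x : ℂ)) η‖ ≤ 1 := by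
  rw [Real.fourierInv_eq]
  refine (norm_integral_le_integral_norm _).trans_eq ?_
  rw [← ρ.integral_normed (μ := volume)]
  congr 1; ext x
  simp [Circle.norm_smul, abs_of_nonneg (ρ.nonneg_normed x)]

/-- The transform at `η` is the convolution of the bump with the continuous character `x ↦ e(-x·η)`,
evaluated at `0`, where the character equals `1`. -/
theorem tendsto_fourierInv_normed {ρ : ℕ → ContDiffBump (0 : E)}
    (hρ : Filter.Tendsto (fun n => (ρ n).rOut) Filter.atTop (𝓝 0)) (η : E) :
    Filter.Tendsto (fun n => 𝓕⁻ (fun x => ((ρ n).normed volume x : ℂ)) η) Filter.atTop (𝓝 1) := by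
  have h := ContDiffBump.convolution_tendsto_right_of_continuous (μ := volume) hρ
    (g := fun x : E => ((Real.fourierChar (-(inner ℝ x η)) : Circle) : ℂ))
    (by have := Real.continuous_fourierChar; fun_prop) 0
  simp only [inner_zero_left, neg_zero, AddChar.map_zero_eq_one, Circle.coe_one] at h
  refine h.congr fun n => ?_
  rw [Real.fourierInv_eq, convolution_def]
  congr 1; ext x
  simp only [zero_sub, inner_neg_left, neg_neg, ContinuousLinearMap.lsmul_apply,
    Complex.real_smul, Circle.smul_def, smul_eq_mul]
  rw [mul_comm]

theorem fourierInv_comp_sub (w : E → ℂ) (a η : E) :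
    𝓕⁻ (fun x => w (x - a)) η = Real.fourierChar (inner ℝ a η) • 𝓕⁻ w η := by
  have h := integral_sub_right_eq_self
    (fun x => Real.fourierChar (inner ℝ (x + a) η) • w x) a (μ := volume)
  simp only [sub_add_cancel] at h
  rw [Real.fourierInv_eq, Real.fourierInv_eq, h, Circle.smul_def, ← integral_smul]
  congr 1; ext x
  rw [inner_add_left, AddChar.map_add_eq_mul]
  simp only [Circle.smul_def, smul_eq_mul, Circle.coe_mul]
  ring

theorem fourierInv_convolution {f g : E → ℂ} (hf : Integrable f) (hg : Integrable g) (η : E) :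
    𝓕⁻ (f ⋆[ContinuousLinearMap.lsmul ℂ ℂ] g) η = 𝓕⁻ f η * 𝓕⁻ g η := by
  simp only [Real.fourierInv_eq_fourier_neg]
  rw [Real.fourier_smul_convolution_eq hf hg, smul_eq_mul]

/-- If small translates of the support of `w ∈ H^{1/2}` in the direction `d` lie in the open set `O`,
then `w` is annihilated by the elements of `H^{-1/2}` which vanish in `O`. -/
theorem integral_mul_fourierInv_eq_zero_of_translate {v : E → ℂ} (hvm : AEStronglyMeasurable v)
    (hv : FiniteNegHalf v) {O : Set E} (hOo : IsOpen O)
    (hO : ∀ φ : E → ℝ, ContDiff ℝ ∞ φ → HasCompactSupport φ → tsupport φ ⊆ O →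
      ∫ η, v η * 𝓕⁻ (fun x => (φ x : ℂ)) η = 0)
    {K : Set E} (hK : IsCompact K) {d : E} {ε₀ : ℝ} (hε₀ : 0 < ε₀)
    (hd : ∀ ε : ℝ, 0 < ε → ε < ε₀ → ∀ x ∈ K, x + ε • d ∈ O)
    {w : E → ℂ} (hw : Integrable w) (hwK : ∀ x ∉ K, w x = 0) (hW : FiniteHalf (𝓕⁻ w)) :
    ∫ η, v η * 𝓕⁻ w η = 0 := by
  have hWc := continuous_fourierInv hw
  have hint := hv.integrable_mul hvm hW hWc.aestronglyMeasurable
  -- The shift `n + 2` makes `ε n < ε₀` strict already for `n = 0`.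
  set ε : ℕ → ℝ := fun n => ε₀ / (n + 2) with hε
  have hεpos : ∀ n, 0 < ε n := fun n => by positivity
  have hεlt : ∀ n, ε n < ε₀ := fun n => by
    rw [hε]; simp only
    rw [div_lt_iff₀ (by positivity)]
    nlinarith [(Nat.cast_nonneg n : (0 : ℝ) ≤ n)]
  have hεlim : Filter.Tendsto ε Filter.atTop (𝓝 0) :=
    Filter.Tendsto.div_atTop tendsto_const_nhds
      (Filter.tendsto_atTop_add_const_right _ _ tendsto_natCast_atTop_atTop)
  set Kn : ℕ → Set E := fun n => (fun x => x + ε n • d) '' K with hKn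
  have hKnc : ∀ n, IsCompact (Kn n) := fun n => hK.image (by fun_prop)
  have hKnO : ∀ n, Kn n ⊆ O := fun n => by
    rintro _ ⟨x, hx, rfl⟩
    exact hd _ (hεpos n) (hεlt n) x hx
  -- The translated compact set has room inside `O`, and the mollifier radius is kept below that
  -- room and below `1 / (n + 1)`.
  choose δ hδpos hδO using fun n => (hKnc n).exists_cthickening_subset_open hOo (hKnO n)
  set r : ℕ → ℝ := fun n => min (δ n) (1 / ((n : ℝ) + 1)) with hr
  have hrpos : ∀ n, 0 < r n := fun n => lt_min (hδpos n) (by positivity)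
  set ρ : ℕ → ContDiffBump (0 : E) := fun n => ⟨r n / 2, r n, half_pos (hrpos n),
    half_lt_self (hrpos n)⟩ with hρ
  have hρlim : Filter.Tendsto (fun n => (ρ n).rOut) Filter.atTop (𝓝 0) :=
    squeeze_zero (fun n => (hrpos n).le) (fun n => min_le_right _ _)
      tendsto_one_div_add_atTop_nhds_zero_nat
  set wn : ℕ → E → ℂ := fun n x => w (x - ε n • d) with hwn
  have hwni : ∀ n, Integrable (wn n) := fun n => hw.comp_sub_right _
  set ψ : ℕ → E → ℂ := fun n =>
    (ρ n).normed volume ⋆[ContinuousLinearMap.lsmul ℝ ℝ] wn n with hψ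
  have hψsupp : ∀ n, tsupport (ψ n) ⊆ Metric.cthickening (δ n) (Kn n) := fun n => by
    refine closure_minimal ?_ Metric.isClosed_cthickening
    refine (support_convolution_subset _).trans ?_
    rintro _ ⟨x, hx, y, hy, rfl⟩
    rw [ContDiffBump.support_normed_eq, Metric.mem_ball, dist_zero_right] at hx
    have hy' : y ∈ Kn n := by
      by_contra hcon
      refine hy (hwK _ fun hyK => hcon ⟨_, hyK, ?_⟩)
      simp
    refine Metric.mem_cthickening_of_dist_le _ y _ _ hy' ?_
    rw [dist_eq_norm]
    simpa using (hx.le.trans (min_le_left _ _))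
  have hψc : ∀ n, HasCompactSupport (ψ n) := fun n =>
    (hKnc n).cthickening.of_isClosed_subset (isClosed_tsupport _) (hψsupp n)
  have hψs : ∀ n, ContDiff ℝ ∞ (ψ n) := fun n =>
    (ρ n).hasCompactSupport_normed.contDiff_convolution_left _ (ρ n).contDiff_normed
      (hwni n).locallyIntegrable
  have hψF : ∀ n η, 𝓕⁻ (ψ n) η = 𝓕⁻ (fun x => ((ρ n).normed volume x : ℂ)) η *
      (Real.fourierChar (inner ℝ (ε n • d) η) • 𝓕⁻ w η) := fun n η => by
    rw [← fourierInv_comp_sub]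
    exact fourierInv_convolution (ρ n).integrable_normed.ofReal (hwni n) η
  have hzero : ∀ n, ∫ η, v η * 𝓕⁻ (ψ n) η = 0 := fun n =>
    integral_mul_fourierInv_complex hvm hv hO (hψs n) (hψc n) ((hψsupp n).trans (hδO n))
  -- In frequency, translation and mollification multiply `𝓕⁻ w` by factors of modulus at most one
  -- which tend to one, so dominated convergence applies.
  have hlim : Filter.Tendsto (fun n => ∫ η, v η * 𝓕⁻ (ψ n) η) Filter.atTop
      (𝓝 (∫ η, v η * 𝓕⁻ w η)) := by
    refine tendsto_integral_of_dominated_convergence (fun η => ‖v η * 𝓕⁻ w η‖) (fun n => ?_)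
      hint.norm (fun n => Filter.Eventually.of_forall fun η => ?_)
      (Filter.Eventually.of_forall fun η => ?_)
    · exact hvm.mul (continuous_fourierInv
        ((hψs n).continuous.integrable_of_hasCompactSupport (hψc n))).aestronglyMeasurable
    · rw [hψF, norm_mul, norm_mul, norm_mul, Circle.norm_smul]
      gcongr
      exact mul_le_of_le_one_left (norm_nonneg _) (norm_fourierInv_normed_le _ _)
    · simp only [hψF]
      have h1 := tendsto_fourierInv_normed hρlim η
      have h2 : Filter.Tendsto (fun n => ((Real.fourierChar (inner ℝ (ε n • d) η) : Circle) : ℂ))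
          Filter.atTop (𝓝 1) := by
        have hc : Continuous fun t : ℝ =>
            ((Real.fourierChar (inner ℝ (t • d) η) : Circle) : ℂ) := by
          have := Real.continuous_fourierChar
          fun_prop
        have := (hc.tendsto 0).comp hεlim
        simpa [Function.comp_def] using this
      have h3 := ((h1.mul (h2.mul_const (𝓕⁻ w η))).const_mul (v η))
      simpa [Circle.smul_def] using h3
  exact (tendsto_nhds_unique hlim (by simp only [hzero]; exact tendsto_const_nhds))

/-- The segment property of a set at a point. -/
def SegmentPropertyAt (G : Set E) (x : E) : Prop :=
  ∃ U ∈ 𝓝 x, ∃ d : E, ∀ y ∈ closure G ∩ U, ∀ ε : ℝ, 0 < ε → y + ε • d ∈ U → y + ε • d ∈ G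

/-- Around a point with the segment property there is a cutoff function such that the elements of
`H^{-1/2}` which vanish in `G` annihilate the localisations of the elements of `H^{1/2}` supported in
`closure G`. -/
theorem exists_cutoff_of_segmentPropertyAt {v : E → ℂ} (hvm : AEStronglyMeasurable v)
    (hv : FiniteNegHalf v) {G : Set E} (hG : IsOpen G)
    (hO : ∀ φ : E → ℝ, ContDiff ℝ ∞ φ → HasCompactSupport φ → tsupport φ ⊆ G →
      ∫ η, v η * 𝓕⁻ (fun x => (φ x : ℂ)) η = 0) {x : E} (hx : SegmentPropertyAt G x) :
    ∃ χ : 𝓢(E, ℂ), {y | χ y = 1} ∈ 𝓝 x ∧ ∀ w : E → ℂ, Integrable w →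
      (∀ y ∉ closure G, w y = 0) → FiniteHalf (𝓕⁻ w) →
      ∫ η, v η * 𝓕⁻ (fun y => χ y * w y) η = 0 := by
  obtain ⟨U, hU, d, hd⟩ := hx
  obtain ⟨R, hR, hRU⟩ := Metric.mem_nhds_iff.1 hU
  let ρ : ContDiffBump x := ⟨R / 4, R / 2, by positivity, by linarith⟩
  refine ⟨schwartzOfReal ρ ρ.contDiff ρ.hasCompactSupport, ?_, fun w hw hwG hW => ?_⟩
  · filter_upwards [ρ.eventuallyEq_one] with y hy
    change ((ρ y : ℝ) : ℂ) = 1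
    rw [hy]; simp
  · set χ := schwartzOfReal ρ ρ.contDiff ρ.hasCompactSupport with hχ
    have hχa : ∀ y, χ y = (ρ y : ℂ) := fun _ => rfl
    have hK : IsCompact (closure G ∩ Metric.closedBall x (R / 2)) :=
      (isCompact_closedBall x (R / 2)).inter_left isClosed_closure
    -- The support of `χ w` lies within `R / 2` of `x`, and shifts by `ε • d` are shorter than `R /
    -- 2`, so they stay in the ball contained in `U`. The summand `1` covers `d = 0`.
    refine integral_mul_fourierInv_eq_zero_of_translate hvm hv hG hO hK
      (d := d) (ε₀ := R / 2 / (‖d‖ + 1)) (by positivity) ?_ ?_ ?_ (hW.schwartz_mul χ hw)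
    · intro ε hε hε0 y hy
      have hyx : dist y x ≤ R / 2 := hy.2
      rw [lt_div_iff₀ (by positivity)] at hε0
      refine hd y ⟨hy.1, hRU ?_⟩ ε hε (hRU ?_)
      · rw [Metric.mem_ball]; linarith
      · rw [Metric.mem_ball, dist_eq_norm, add_sub_right_comm]
        refine (norm_add_le _ _).trans_lt ?_
        rw [← dist_eq_norm, norm_smul, Real.norm_of_nonneg hε.le]
        nlinarith
    · exact hw.bdd_mul (c := 1) χ.continuous.aestronglyMeasurable
        (Filter.Eventually.of_forall fun y => by
          rw [hχa, Complex.norm_real, Real.norm_of_nonneg ρ.nonneg]; exact ρ.le_one)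
    · intro y hy
      by_cases h1 : y ∈ closure G
      · have h2 : y ∉ Metric.ball x ρ.rOut := fun h2 =>
          hy ⟨h1, Metric.ball_subset_closedBall h2⟩
        have : ρ y = 0 := by
          rw [← Function.notMem_support, ρ.support_eq]; exact h2
        simp [hχa, this]
      · simp [hwG y h1]

/-- If the bounded open set `G` has the segment property, elements of `H^{-1/2}` vanishing in `G`
annihilate the elements of `H^{1/2}` supported in `closure G`. -/
theorem integral_mul_fourierInv_eq_zero {v : E → ℂ} (hvm : AEStronglyMeasurable v)
    (hv : FiniteNegHalf v) {G : Set E} (hG : IsOpen G) (hGb : Bornology.IsBounded G)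
    (hO : ∀ φ : E → ℝ, ContDiff ℝ ∞ φ → HasCompactSupport φ → tsupport φ ⊆ G →
      ∫ η, v η * 𝓕⁻ (fun x => (φ x : ℂ)) η = 0)
    (hseg : ∀ x ∈ closure G, SegmentPropertyAt G x)
    {w : E → ℂ} (hw : Integrable w) (hwG : ∀ y ∉ closure G, w y = 0) (hW : FiniteHalf (𝓕⁻ w)) :
    ∫ η, v η * 𝓕⁻ w η = 0 := by
  choose! χ hχ1 hχ0 using fun x hx => exists_cutoff_of_segmentPropertyAt hvm hv hG hO (hseg x hx)
  obtain ⟨t, htG, htc⟩ := hGb.isCompact_closure.elim_nhds_subcover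
    (fun x => {y | χ x y = 1}) hχ1
  -- Instead of a partition of unity, the pieces `χ x * w` are removed one by one: `w - χ x * w`
  -- vanishes where `χ x = 1` and wherever `w` did, so induction on the finite cover ends with zero.
  suffices H : ∀ s : Finset E, (∀ x ∈ s, x ∈ closure G) →
      ∀ w : E → ℂ, Integrable w → (∀ y ∉ closure G, w y = 0) → FiniteHalf (𝓕⁻ w) →
      (∀ y ∈ closure G, (∃ x ∈ s, χ x y = 1) ∨ w y = 0) → ∫ η, v η * 𝓕⁻ w η = 0 by
    refine H t htG w hw hwG hW fun y hy => Or.inl ?_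
    simpa using htc hy
  classical
  intro s
  induction s using Finset.induction_on with
  | empty =>
    intro _ w _ hwG _ h0
    have : w = fun _ => 0 := by
      ext y
      by_cases hy : y ∈ closure G
      · simpa using h0 y hy
      · exact hwG y hy
    simp [this, Real.fourierInv_eq]
  | insert x s hxs ih =>
    intro hs w hw hwG hW h0
    have hx := hs x (Finset.mem_insert_self x s)
    obtain ⟨C, hC⟩ : ∃ C, ∀ y, ‖χ x y‖ ≤ C := by
      obtain ⟨C, hC⟩ := (χ x).decay 0 0
      exact ⟨C, fun y => by simpa using hC.2 y⟩
    have hχw : Integrable (fun y => χ x y * w y) :=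
      hw.bdd_mul (c := C) (χ x).continuous.aestronglyMeasurable (Filter.Eventually.of_forall hC)
    have hχW := hW.schwartz_mul (χ x) hw
    set w' : E → ℂ := fun y => w y - χ x y * w y with hw'
    have hF : ∀ η, 𝓕⁻ w' η = 𝓕⁻ w η - 𝓕⁻ (fun y => χ x y * w y) η := fun η => by
      simp only [Real.fourierInv_eq, hw', smul_sub]
      refine integral_sub ?_ ?_
      · simpa using (Real.fourierIntegral_convergent_iff (f := w) (-η)).2 hw
      · simpa using (Real.fourierIntegral_convergent_iff (f := fun y => χ x y * w y) (-η)).2 hχw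
    have hW' : FiniteHalf (𝓕⁻ w') := by
      have hle : ∀ η, (1 + ‖η‖ₑ) * ‖𝓕⁻ w' η‖ₑ ^ 2 ≤ 4 * ((1 + ‖η‖ₑ) * ‖𝓕⁻ w η‖ₑ ^ 2 +
          (1 + ‖η‖ₑ) * ‖𝓕⁻ (fun y => χ x y * w y) η‖ₑ ^ 2) := fun η => by
        rw [hF, ← mul_add, mul_left_comm]
        gcongr
        have h1 : ‖𝓕⁻ w η - 𝓕⁻ (fun y => χ x y * w y) η‖ₑ ≤ _ := enorm_sub_le
        exact (pow_le_pow_left' h1 2).trans (add_sq_le_four_mul _ _)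
      refine (lintegral_mono hle).trans_lt ?_
      rw [lintegral_const_mul' _ _ (by simp), lintegral_add_left (by
        exact (measurable_const.add measurable_enorm).mul
          ((continuous_fourierInv hw).enorm.measurable.pow_const 2))]
      exact ENNReal.mul_lt_top (by simp) (ENNReal.add_lt_top.2 ⟨hW, hχW⟩)
    have hih := ih (fun z hz => hs z (Finset.mem_insert_of_mem hz)) w' (hw.sub hχw)
      (fun y hy => by simp [hw', hwG y hy]) hW' fun y hy => by
        rcases h0 y hy with ⟨z, hz, hzy⟩ | h
        · rcases Finset.mem_insert.1 hz with rfl | hz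
          · right; simp [hw', hzy]
          · exact Or.inl ⟨z, hz, hzy⟩
        · right; simp [hw', h]
    have h0' := hχ0 x hx w hw hwG hW
    have hi1 := hv.integrable_mul hvm hW (continuous_fourierInv hw).aestronglyMeasurable
    have hi2 := hv.integrable_mul hvm hχW (continuous_fourierInv hχw).aestronglyMeasurable
    calc ∫ η, v η * 𝓕⁻ w η
        = (∫ η, v η * 𝓕⁻ w η) - ∫ η, v η * 𝓕⁻ (fun y => χ x y * w y) η := by rw [h0', sub_zero]
      _ = ∫ η, v η * 𝓕⁻ w' η := by
          rw [← integral_sub hi1 hi2]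
          congr 1; ext η; rw [hF]; ring
      _ = 0 := hih

end Localization

end FlatContact

/-! ### Lipschitz sets and the orthogonality of `H̃^{-1/2}` outside and `H̃^{1/2}` inside. -/

namespace FlatContact

open scoped FourierTransform SchwartzMap ContDiff

/-- Lipschitz open sets have the segment property. -/
theorem IsLipschitzSet.segmentPropertyAt {G : Set Plane} (hL : IsLipschitzSet G) (hG : IsOpen G)
    {x : Plane} (hx : x ∈ closure G) : SegmentPropertyAt G x := by
  by_cases hxG : x ∈ G
  -- At an interior point `G` itself is the neighbourhood and no shift is needed.
  · exact ⟨G, hG.mem_nhds hxG, 0, fun y _ ε _ h => h⟩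
  · have hfr : x ∈ frontier G := by
      rw [frontier, hG.interior_eq]; exact ⟨hx, hxG⟩
    obtain ⟨e, f, L, hf, hev⟩ := hL x hfr
    obtain ⟨U, hU, hUo, hxU⟩ := mem_nhds_iff.1 hev
    -- The direction is vertical in the graph coordinates: on `closure G` the graph inequality holds
    -- weakly, and raising the point makes it strict.
    refine ⟨U, hUo.mem_nhds hxU, e.symm (EuclideanSpace.single 1 1), fun y hy ε hε hyε => ?_⟩
    have hle : f (e y 0) ≤ e y 1 := by
      have hcl : y ∈ closure (G ∩ U) := by
        rw [mem_closure_iff_nhds]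
        intro t ht
        obtain ⟨z, hz, hzG⟩ := mem_closure_iff_nhds.1 hy.1 (t ∩ U)
          (Filter.inter_mem ht (hUo.mem_nhds hy.2))
        exact ⟨z, hz.1, hzG, hz.2⟩
      have hclosed : IsClosed {z : Plane | f (e z 0) ≤ e z 1} := by
        have := hf.continuous
        exact isClosed_le (by fun_prop) (by fun_prop)
      refine closure_minimal (fun z hz => ?_) hclosed hcl
      exact ((hU hz.2).1 hz.1).le
    refine (hU hyε).2 ?_
    have h0 : e (y + ε • e.symm (EuclideanSpace.single 1 1)) 0 = e y 0 := by
      simp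
    have h1 : e (y + ε • e.symm (EuclideanSpace.single 1 1)) 1 = e y 1 + ε := by
      simp
    rw [h0, h1]
    linarith

theorem lintegral_comp_two_pi_smul (f : Plane → ℝ≥0∞) :
    ∫⁻ η, f ((2 * Real.pi) • η) = ENNReal.ofReal (((2 * Real.pi) ^ 2)⁻¹) * ∫⁻ ξ, f ξ := by
  have hne : (2 * Real.pi) ≠ 0 := by positivity
  have h := lintegral_map_equiv f
    (Homeomorph.smul (isUnit_iff_ne_zero.2 hne).unit : Plane ≃ₜ Plane).toMeasurableEquiv
    (μ := volume)
  have hc : ⇑(Homeomorph.smul (isUnit_iff_ne_zero.2 hne).unit : Plane ≃ₜ Plane).toMeasurableEquiv =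
    fun η : Plane => (2 * Real.pi) • η := rfl
  rw [hc, Measure.map_addHaar_smul _ hne, lintegral_smul_measure] at h
  rw [← h, abs_of_pos (by positivity)]
  simp

/-- In the constant, `1 / ‖τ‖` dominates the summand `1` of the weight, which the parameter norm
sees as `‖τ‖`; the other summand is harmless because `2π ≥ 1`. -/
theorem FiniteHalf.of_wnormSq {τ : ℂ} (hτ : τ ≠ 0) {V : Plane → ℂ}
    (hV : wnormSq (1 / 2) τ V < ⊤) : FiniteHalf (fun η => V ((2 * Real.pi) • η)) := by
  have hpos : 0 < ‖τ‖ := norm_pos_iff.2 hτ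
  have hle : ∀ η : Plane, (1 + ‖η‖ₑ) * ‖V ((2 * Real.pi) • η)‖ₑ ^ 2 ≤
      ENNReal.ofReal (1 / ‖τ‖ + 1) * (ENNReal.ofReal
        ((‖τ‖ ^ 2 + ‖(2 * Real.pi) • η‖ ^ 2) ^ (1 / 2 : ℝ)) * ‖V ((2 * Real.pi) • η)‖ₑ ^ 2) := by
    intro η
    rw [← mul_assoc, ← ENNReal.ofReal_mul (by positivity)]
    gcongr
    rw [← ofReal_norm, ← ENNReal.ofReal_one, ← ENNReal.ofReal_add (by norm_num) (norm_nonneg _)]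
    apply ENNReal.ofReal_le_ofReal
    rw [← Real.sqrt_eq_rpow]
    have hpi := Real.pi_gt_three
    have h1 : ‖τ‖ ≤ √(‖τ‖ ^ 2 + ‖(2 * Real.pi) • η‖ ^ 2) :=
      Real.le_sqrt_of_sq_le (by nlinarith [sq_nonneg ‖(2 * Real.pi) • η‖])
    have h2 : ‖η‖ ≤ √(‖τ‖ ^ 2 + ‖(2 * Real.pi) • η‖ ^ 2) := by
      refine Real.le_sqrt_of_sq_le ?_
      rw [norm_smul, Real.norm_of_nonneg (by positivity), mul_pow]
      have : 1 ≤ (2 * Real.pi) ^ 2 := by nlinarith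
      nlinarith [sq_nonneg ‖η‖, sq_nonneg ‖τ‖]
    rw [add_mul, one_mul]
    refine add_le_add ?_ h2
    rw [one_div, inv_mul_eq_div, le_div_iff₀ hpos, one_mul]
    exact h1
  refine (lintegral_mono hle).trans_lt ?_
  rw [lintegral_const_mul' _ _ ENNReal.ofReal_ne_top, lintegral_comp_two_pi_smul (fun ξ => ENNReal.ofReal
        ((‖τ‖ ^ 2 + ‖ξ‖ ^ 2) ^ (1 / 2 : ℝ)) * ‖V ξ‖ₑ ^ 2)]
  exact ENNReal.mul_lt_top ENNReal.ofReal_lt_top (ENNReal.mul_lt_top ENNReal.ofReal_lt_top hV)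

theorem FiniteNegHalf.of_wnormSq {v : Plane → ℂ}
    (hv : wnormSq (-1 / 2) 1 v < ⊤) : FiniteNegHalf (fun η => v ((2 * Real.pi) • η)) := by
  have hle : ∀ η : Plane, (1 + ‖η‖ₑ)⁻¹ * ‖v ((2 * Real.pi) • η)‖ₑ ^ 2 ≤
      ENNReal.ofReal (2 * Real.pi) * (ENNReal.ofReal
        ((‖(1 : ℂ)‖ ^ 2 + ‖(2 * Real.pi) • η‖ ^ 2) ^ (-1 / 2 : ℝ)) *
          ‖v ((2 * Real.pi) • η)‖ₑ ^ 2) := by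
    intro η
    rw [← mul_assoc, ← ENNReal.ofReal_mul (by positivity)]
    gcongr
    rw [← ofReal_norm, ← ENNReal.ofReal_one, ← ENNReal.ofReal_add (by norm_num) (norm_nonneg _),
      ← ENNReal.ofReal_inv_of_pos (by positivity)]
    apply ENNReal.ofReal_le_ofReal
    rw [neg_div, Real.rpow_neg (by positivity), ← Real.sqrt_eq_rpow, norm_one, one_pow,
      ← div_eq_mul_inv, inv_eq_one_div, div_le_div_iff₀ (by positivity) (by positivity), one_mul]
    rw [Real.sqrt_le_left (by positivity), norm_smul, Real.norm_of_nonneg (by positivity)]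
    have hpi := Real.pi_gt_three
    have : 1 ≤ (2 * Real.pi) ^ 2 := by nlinarith
    nlinarith [norm_nonneg η, mul_nonneg (sq_nonneg (2 * Real.pi)) (norm_nonneg η)]
  refine (lintegral_mono hle).trans_lt ?_
  rw [lintegral_const_mul' _ _ ENNReal.ofReal_ne_top, lintegral_comp_two_pi_smul (fun ξ => ENNReal.ofReal
        ((‖(1 : ℂ)‖ ^ 2 + ‖ξ‖ ^ 2) ^ (-1 / 2 : ℝ)) * ‖v ξ‖ₑ ^ 2)]
  exact ENNReal.mul_lt_top ENNReal.ofReal_lt_top (ENNReal.mul_lt_top ENNReal.ofReal_lt_top hv)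

theorem memLp_two_of_wnormSq {τ : ℂ} (hτ : τ ≠ 0) {V : Plane → ℂ} (hVm : AEStronglyMeasurable V)
    (hV : wnormSq (1 / 2) τ V < ⊤) : MemLp V 2 := by
  have hpos : 0 < ‖τ‖ := norm_pos_iff.2 hτ
  rw [memLp_two_iff_integrable_sq_norm hVm]
  refine ⟨(hVm.norm.pow 2), ?_⟩
  have hle : ∀ ξ : Plane, ‖‖V ξ‖ ^ 2‖ₑ ≤ ENNReal.ofReal ‖τ‖⁻¹ *
      (ENNReal.ofReal ((‖τ‖ ^ 2 + ‖ξ‖ ^ 2) ^ (1 / 2 : ℝ)) * ‖V ξ‖ₑ ^ 2) := fun ξ => by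
    rw [← mul_assoc, ← ENNReal.ofReal_mul (by positivity), enorm_pow, enorm_norm]
    refine le_mul_of_one_le_left' ?_
    rw [ENNReal.one_le_ofReal, ← Real.sqrt_eq_rpow, inv_mul_eq_div, le_div_iff₀ hpos, one_mul]
    exact Real.le_sqrt_of_sq_le (by nlinarith [sq_nonneg ‖ξ‖])
  refine (lintegral_mono hle).trans_lt ?_
  rw [lintegral_const_mul' _ _ ENNReal.ofReal_ne_top]
  exact ENNReal.mul_lt_top ENNReal.ofReal_lt_top hV

theorem integrable_of_comp_two_pi_smul {f : Plane → ℂ}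
    (hf : Integrable fun η => f ((2 * Real.pi) • η)) : Integrable f :=
  (integrable_comp_smul_iff volume f (by positivity)).1 hf

theorem aestronglyMeasurable_comp_two_pi_smul {f : Plane → ℂ} (hf : AEStronglyMeasurable f) :
    AEStronglyMeasurable fun η : Plane => f ((2 * Real.pi) • η) := by
  refine hf.comp_quasiMeasurePreserving (f := fun η : Plane => (2 * Real.pi) • η)
    ⟨measurable_const_smul _, ?_⟩
  rw [Measure.map_addHaar_smul _ (by positivity)]
  exact Measure.smul_absolutelyContinuous

/-- In a bounded Lipschitz open set, `H̃^{-1/2}(ℝ² ∖ closure G)` and `H̃^{1/2}(G)` are orthogonal. -/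
theorem integral_tildeHat_mul_conj_eq_zero {G : Set Plane} (hG : IsOpen G)
    (hGb : Bornology.IsBounded G) (hL : IsLipschitzSet G) {τ : ℂ} (hτ : τ ≠ 0) {V : Plane → ℂ}
    (hVm : AEStronglyMeasurable V) (hV : wnormSq (1 / 2) τ V < ⊤)
    (hVs : ∀ φ : Plane → ℝ, ContDiff ℝ ∞ φ → HasCompactSupport φ → tsupport φ ⊆ (closure G)ᶜ →
      ∫ ξ, V ξ * angularInv (fun x => (φ x : ℂ)) ξ = 0)
    {v : Plane → ℂ} (hv : IsTildeHat (-1 / 2) (closure G)ᶜ v) :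
    Integrable (fun ξ => v ξ * (starRingEnd ℂ) (V ξ)) ∧
      ∫ ξ, v ξ * (starRingEnd ℂ) (V ξ) = 0 := by
  have hV2 := memLp_two_of_wnormSq hτ hVm hV
  obtain ⟨w, hw, hψ, hF⟩ := exists_angular_inverse hV2
  have hw0 : ∀ᵐ x, x ∈ (closure G)ᶜ → w x = 0 := by
    refine IsOpen.ae_eq_zero_of_integral_contDiff_smul_eq_zero isClosed_closure.isOpen_compl
      ((hw.locallyIntegrable (by norm_num)).locallyIntegrableOn _) fun φ hφ hs hsG => ?_
    have := hψ (schwartzOfReal φ hφ hs) (hVs φ hφ hs hsG)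
    simpa [schwartzOfReal_coe, mul_comm] using this
  -- Changing `w` on a null set makes it vanish everywhere outside `closure G`; being square
  -- integrable on a bounded set, it is then integrable.
  set w₀ : Plane → ℂ := (closure G).indicator w with hw₀
  have hww₀ : w =ᵐ[volume] w₀ := by
    filter_upwards [hw0] with x hx
    by_cases h : x ∈ closure G
    · simp [hw₀, h]
    · simp [hw₀, h, hx h]
  have hw₀i : Integrable w₀ := by
    rw [hw₀, integrable_indicator_iff isClosed_closure.measurableSet]
    have : IsFiniteMeasure (volume.restrict (closure G)) :=
      ⟨by rw [Measure.restrict_apply_univ]; exact hGb.isCompact_closure.measure_lt_top⟩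
    exact (hw.restrict (closure G)).integrable (by norm_num)
  have hF' := hF (hw₀i.congr hww₀.symm)
  have hFw : 𝓕 w = 𝓕 w₀ := by
    ext η
    rw [Real.fourier_eq, Real.fourier_eq]
    refine integral_congr_ae ?_
    filter_upwards [hww₀] with x hx
    rw [hx]
  -- Conjugation turns the forward transform into the inverse one, matching the conjugate in the
  -- pairing.
  set W : Plane → ℂ := fun x => (starRingEnd ℂ) (w₀ x) with hW
  have hWi : Integrable W :=
    (Complex.conjCLE.toContinuousLinearMap.integrable_comp hw₀i :)
  have hFW : ∀ η, 𝓕⁻ W η = (starRingEnd ℂ) (𝓕 w₀ η) := fun η => by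
    rw [Real.fourierInv_eq, Real.fourier_eq, ← integral_conj]
    congr 1; ext x
    simp only [Circle.smul_def, smul_eq_mul, hW, map_mul, AddChar.map_neg_eq_inv,
      Circle.coe_inv_eq_conj, Complex.conj_conj]
  have hae : ∀ᵐ η, (starRingEnd ℂ) (V ((2 * Real.pi) • η)) = 𝓕⁻ W η := by
    filter_upwards [hF'] with η hη
    rw [hη, hFw, hFW]
  have hWH : FiniteHalf (𝓕⁻ W) := by
    refine lt_of_eq_of_lt (lintegral_congr_ae ?_) (FiniteHalf.of_wnormSq hτ hV)
    filter_upwards [hae] with η hη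
    rw [← hη, RCLike.enorm_conj]
  have hvm' := aestronglyMeasurable_comp_two_pi_smul hv.meas
  have hv' := FiniteNegHalf.of_wnormSq hv.finite
  have hprod : (fun η => v ((2 * Real.pi) • η) * (starRingEnd ℂ) (V ((2 * Real.pi) • η)))
      =ᵐ[volume] fun η => v ((2 * Real.pi) • η) * 𝓕⁻ W η := by
    filter_upwards [hae] with η hη
    rw [hη]
  constructor
  · refine integrable_of_comp_two_pi_smul ?_
    exact (hv'.integrable_mul hvm' hWH (continuous_fourierInv hWi).aestronglyMeasurable).congr
      hprod.symm
  · have h := integral_mul_fourierInv_eq_zero hvm' hv' hG hGb (fun φ hφ hs hsG => ?_)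
      (fun x hx => hL.segmentPropertyAt hG hx) hWi (fun y hy => by simp [hW, hw₀, hy]) hWH
    · rw [← integral_congr_ae hprod, integral_comp_two_pi_smul
        (fun ξ => v ξ * (starRingEnd ℂ) (V ξ)), mul_eq_zero] at h
      refine h.resolve_left ?_
      norm_cast
      positivity
    -- The closure of the exterior is the complement of the interior of `closure G`, and this
    -- interior contains `G`.
    · have hdisj : Disjoint (tsupport φ) (closure (closure G)ᶜ) := by
        rw [closure_compl]
        refine disjoint_compl_right.mono_left (hsG.trans ?_)
        exact hG.subset_interior_iff.2 subset_closure
      have h1 := hv.support ⟨φ, hφ, hs, by simp⟩ hdisj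
      simp_rw [← angularInv_smul]
      rw [integral_comp_two_pi_smul (fun ξ => v ξ * angularInv (fun x => (φ x : ℂ)) ξ)]
      refine mul_eq_zero_of_right _ h1

end FlatContact

/-! ### From space-time distributions to frequency slices. -/

namespace FlatContact

open scoped FourierTransform SchwartzMap ContDiff

theorem le_norm_freq {σ : ℝ} (ξ₀ : ℝ) : σ ≤ ‖freq σ ξ₀‖ := by
  have h : (freq σ ξ₀).im = σ := by simp [freq]
  calc σ = (freq σ ξ₀).im := h.symm
    _ ≤ |(freq σ ξ₀).im| := le_abs_self _
    _ ≤ ‖freq σ ξ₀‖ := Complex.abs_im_le_norm _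

theorem norm_freq_pos {σ : ℝ} (hσ : 0 < σ) (ξ₀ : ℝ) : 0 < ‖freq σ ξ₀‖ :=
  hσ.trans_le (le_norm_freq ξ₀)

theorem freq_ne_zero {σ : ℝ} (hσ : 0 < σ) (ξ₀ : ℝ) : freq σ ξ₀ ≠ 0 :=
  norm_pos_iff.1 (norm_freq_pos hσ ξ₀)

theorem continuous_freq (σ : ℝ) : Continuous (freq σ) := by
  unfold freq; fun_prop

/-- The weight `|ω|^{2s} (|ω|² + |ξ|²)^r` of the space-time norms. -/
noncomputable def stWeight (σ s r : ℝ) (z : SpaceTime) : ℝ :=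
  ‖freq σ z.1‖ ^ (2 * s) * (‖freq σ z.1‖ ^ 2 + ‖z.2‖ ^ 2) ^ r

theorem measurable_stWeight (σ s r : ℝ) : Measurable (stWeight σ s r) := by
  have := (continuous_freq σ).measurable
  unfold stWeight
  fun_prop

theorem stWeight_pos {σ : ℝ} (hσ : 0 < σ) (s r : ℝ) (z : SpaceTime) : 0 < stWeight σ s r z := by
  have := norm_freq_pos hσ z.1
  unfold stWeight
  positivity

theorem stNorm_sq_eq {σ : ℝ} (s r : ℝ) {U : SpaceTime → ℂ}
    (hU : AEStronglyMeasurable U volume) :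
    stNorm σ s r U ^ 2 = ∫⁻ z, ENNReal.ofReal (stWeight σ s r z) * ‖U z‖ₑ ^ 2 := by
  have hw := (measurable_stWeight σ s r).ennreal_ofReal
  rw [stNorm, ← ENNReal.rpow_two, ← ENNReal.rpow_mul, Measure.volume_eq_prod, lintegral_prod]
  · norm_num
    congr 1; ext ξ₀
    rw [wnormSq, ← lintegral_const_mul' _ _ ENNReal.ofReal_ne_top]
    congr 1; ext ξ
    rw [stWeight, ENNReal.ofReal_mul (by positivity), mul_assoc]
  · exact hw.aemeasurable.mul (hU.enorm.pow_const 2)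

theorem stNorm_sq_lt_top {σ s r : ℝ} {U : SpaceTime → ℂ} (h : stNorm σ s r U < ⊤) :
    stNorm σ s r U ^ 2 < ⊤ := ENNReal.pow_lt_top h

theorem ae_wnormSq_lt_top {σ : ℝ} (hσ : 0 < σ) {s r : ℝ} {U : SpaceTime → ℂ}
    (hU : AEStronglyMeasurable U volume) (h : stNorm σ s r U < ⊤) :
    ∀ᵐ ξ₀ : ℝ, wnormSq r (freq σ ξ₀) (fun ξ => U (ξ₀, ξ)) < ⊤ := by
  have h2 := stNorm_sq_lt_top h
  have hm : AEMeasurable (fun z => ENNReal.ofReal (stWeight σ s r z) * ‖U z‖ₑ ^ 2)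
      (volume : Measure SpaceTime) :=
    (measurable_stWeight σ s r).ennreal_ofReal.aemeasurable.mul (hU.enorm.pow_const 2)
  rw [stNorm_sq_eq s r hU, Measure.volume_eq_prod, lintegral_prod _ hm] at h2
  filter_upwards [ae_lt_top' hm.lintegral_prod_right' h2.ne] with ξ₀ hξ
  have hne : ENNReal.ofReal (‖freq σ ξ₀‖ ^ (2 * s)) ≠ 0 := by
    have := norm_freq_pos hσ ξ₀
    rw [ne_eq, ENNReal.ofReal_eq_zero, not_le]
    positivity
  refine ENNReal.lt_top_of_mul_ne_top_right (a := ENNReal.ofReal (‖freq σ ξ₀‖ ^ (2 * s))) ?_ hne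
  rw [wnormSq, ← lintegral_const_mul' _ _ ENNReal.ofReal_ne_top]
  refine ne_of_eq_of_ne (lintegral_congr fun ξ => ?_) hξ.ne
  rw [stWeight, ENNReal.ofReal_mul (by positivity), mul_assoc]

theorem ae_aestronglyMeasurable_slice {U : SpaceTime → ℂ} (hU : AEStronglyMeasurable U volume) :
    ∀ᵐ ξ₀ : ℝ, AEStronglyMeasurable (fun ξ : Plane => U (ξ₀, ξ)) := by
  rw [Measure.volume_eq_prod] at hU
  exact hU.prodMk_left

theorem memLp_two_of_stNorm {σ : ℝ} (hσ : 0 < σ) {U : SpaceTime → ℂ}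
    (hU : AEStronglyMeasurable U volume) (h : stNorm σ (1 / 2) (1 / 2) U < ⊤) : MemLp U 2 := by
  rw [memLp_two_iff_integrable_sq_norm hU]
  refine ⟨hU.norm.pow 2, ?_⟩
  have h2 := stNorm_sq_lt_top h
  rw [stNorm_sq_eq _ _ hU] at h2
  have hle : ∀ z, ‖‖U z‖ ^ 2‖ₑ ≤ ENNReal.ofReal (σ * σ)⁻¹ *
      (ENNReal.ofReal (stWeight σ (1 / 2) (1 / 2) z) * ‖U z‖ₑ ^ 2) := fun z => by
    rw [← mul_assoc, ← ENNReal.ofReal_mul (by positivity), enorm_pow, enorm_norm]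
    refine le_mul_of_one_le_left' ?_
    rw [ENNReal.one_le_ofReal, inv_mul_eq_div, le_div_iff₀ (by positivity), one_mul, stWeight,
      ← Real.sqrt_eq_rpow]
    norm_num
    have h1 := le_norm_freq (σ := σ) z.1
    gcongr
    exact h1.trans (Real.le_sqrt_of_sq_le (by nlinarith [sq_nonneg ‖z.2‖]))
  refine (lintegral_mono hle).trans_lt ?_
  rw [lintegral_const_mul' _ _ ENNReal.ofReal_ne_top]
  exact ENNReal.mul_lt_top ENNReal.ofReal_lt_top h2

section AngularL2

variable {E : Type*} [NormedAddCommGroup E] [InnerProductSpace ℝ E] [FiniteDimensional ℝ E]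
  [MeasurableSpace E] [BorelSpace E]

theorem memLp_angularInv {φ : E → ℝ} (hφ : ContDiff ℝ ∞ φ) (hs : HasCompactSupport φ) :
    MemLp (angularInv fun x => (φ x : ℂ)) 2 := by
  set b : 𝓢(E, ℂ) := 𝓕⁻ (schwartzOfReal φ hφ hs) with hb
  have hF : (angularInv fun x => (φ x : ℂ)) = fun ξ => b ((2 * Real.pi)⁻¹ • ξ) := by
    ext ξ
    rw [angularInv_eq, hb, SchwartzMap.fourierInv_coe, schwartzOfReal_coe]
  have hc : Continuous fun ξ : E => b ((2 * Real.pi)⁻¹ • ξ) :=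
    b.continuous.comp (continuous_const_smul _)
  rw [hF, memLp_two_iff_integrable_sq_norm hc.aestronglyMeasurable,
    integrable_comp_smul_iff volume (fun ξ => ‖b ξ‖ ^ 2) (by positivity)]
  exact (memLp_two_iff_integrable_sq_norm b.continuous.aestronglyMeasurable).1 (b.memLp 2)

end AngularL2

/-- The test function `exp(-σt) θ(-t) φ(x)`. -/
noncomputable def productTest (σ : ℝ) {θ : ℝ → ℝ} (hθ : ContDiff ℝ ∞ θ) (hθs : HasCompactSupport θ)
    {φ : Plane → ℝ} (hφ : ContDiff ℝ ∞ φ) (hφs : HasCompactSupport φ) : 𝓓(wholeST, ℝ) where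
  toFun z := Real.exp (-σ * z.1) * θ (-z.1) * φ z.2
  contDiff' := by
    have h1 : ContDiff ℝ ∞ fun z : SpaceTime => θ (-z.1) := hθ.comp contDiff_fst.neg
    have h2 : ContDiff ℝ ∞ fun z : SpaceTime => φ z.2 := hφ.comp contDiff_snd
    exact ((Real.contDiff_exp.comp (contDiff_const.mul contDiff_fst)).mul h1).mul h2
  hasCompactSupport' := by
    refine HasCompactSupport.intro (K := (Neg.neg '' tsupport θ) ×ˢ tsupport φ)
      ((hθs.isCompact.image continuous_neg).prod hφs) fun z hz => ?_
    by_contra hne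
    refine hz ⟨⟨-z.1, subset_tsupport _ fun h => hne ?_, neg_neg _⟩,
      subset_tsupport _ fun h => hne ?_⟩
    · rw [h]; ring
    · rw [h]; ring
  tsupport_subset' := by simp

theorem productTest_apply (σ : ℝ) {θ : ℝ → ℝ} (hθ : ContDiff ℝ ∞ θ) (hθs : HasCompactSupport θ)
    {φ : Plane → ℝ} (hφ : ContDiff ℝ ∞ φ) (hφs : HasCompactSupport φ) (z : SpaceTime) :
    productTest σ hθ hθs hφ hφs z = Real.exp (-σ * z.1) * θ (-z.1) * φ z.2 := rfl

/-- The factor `exp(-σt)` cancels the growth caused by `Im ω = σ`, and the reflection of `θ`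
corrects the sign of the time exponent. -/
theorem dualTransform_productTest (σ : ℝ) {θ : ℝ → ℝ} (hθ : ContDiff ℝ ∞ θ)
    (hθs : HasCompactSupport θ) {φ : Plane → ℝ} (hφ : ContDiff ℝ ∞ φ)
    (hφs : HasCompactSupport φ) (ξ₀ : ℝ) (ξ : Plane) :
    dualTransform (productTest σ hθ hθs hφ hφs) (freq σ ξ₀) ξ =
      angularInv (fun t => (θ t : ℂ)) ξ₀ * angularInv (fun x => (φ x : ℂ)) ξ := by
  have h1 : angularInv (fun t => (θ t : ℂ)) ξ₀ =
      ∫ t : ℝ, Complex.exp (-Complex.I * ξ₀ * t) * θ (-t) := by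
    rw [angularInv, ← integral_neg_eq_self]
    congr 1; ext t
    congr 2
    simp
    ring
  rw [h1, angularInv, ← integral_prod_mul, dualTransform, Measure.volume_eq_prod]
  congr 1; ext z
  rw [productTest_apply, freq]
  push_cast
  have : Complex.exp (-Complex.I * (ξ₀ + Complex.I * σ) * z.1 +
      Complex.I * (inner ℝ z.2 ξ : ℝ)) * Complex.exp (-σ * z.1) =
      Complex.exp (-Complex.I * ξ₀ * z.1) * Complex.exp (Complex.I * (inner ℝ z.2 ξ : ℝ)) := by
    rw [← Complex.exp_add, ← Complex.exp_add]
    congr 1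
    linear_combination (-(σ : ℂ) * z.1) * Complex.I_mul_I
  linear_combination (θ (-z.1) * φ z.2 : ℂ) * this

/-- As a function of `ξ₀` the integral is in `L²`. Against the transform of any `θ` it gives, up to
a nonzero factor, the value of the distribution on a product test function supported away from
`closure G`, which is zero. Injectivity of the transform on `L²` concludes. -/
theorem HTilde.ae_integral_slice_eq_zero {σ : ℝ} (hσ : 0 < σ) {G : Set Plane}
    (u : HTilde σ (1 / 2) (1 / 2) G) {φ : Plane → ℝ} (hφ : ContDiff ℝ ∞ φ)
    (hφs : HasCompactSupport φ) (hφG : tsupport φ ⊆ (closure G)ᶜ) :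
    ∀ᵐ ξ₀ : ℝ, ∫ ξ, u.hat (ξ₀, ξ) * angularInv (fun x => (φ x : ℂ)) ξ = 0 := by
  set B : Plane → ℂ := angularInv fun x => (φ x : ℂ) with hB
  have hB2 : MemLp B 2 := memLp_angularInv hφ hφs
  have hU2 := memLp_two_of_stNorm hσ u.meas u.finite
  set g : ℝ → ℂ := fun ξ₀ => ∫ ξ, u.hat (ξ₀, ξ) * B ξ with hg
  have hUm := u.meas
  rw [Measure.volume_eq_prod] at hUm
  have hgm : AEStronglyMeasurable g :=
    (hUm.mul (hB2.1.comp_snd (μ := (volume : Measure ℝ)))).integral_prod_right'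
  have hUfin : ∫⁻ ξ₀, ∫⁻ ξ, ‖u.hat (ξ₀, ξ)‖ₑ ^ 2 < ⊤ := by
    have h := ((memLp_two_iff_integrable_sq_norm u.meas).1 hU2).2
    rw [HasFiniteIntegral] at h
    simp only [enorm_pow, enorm_norm] at h
    rw [Measure.volume_eq_prod, lintegral_prod _ (hUm.enorm.pow_const 2)] at h
    exact h
  have hBfin : ∫⁻ ξ, ‖B ξ‖ₑ ^ 2 < ⊤ := by
    have h := ((memLp_two_iff_integrable_sq_norm hB2.1).1 hB2).2
    rw [HasFiniteIntegral] at h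
    simpa only [enorm_pow, enorm_norm] using h
  have hg2 : MemLp g 2 := by
    rw [memLp_two_iff_integrable_sq_norm hgm]
    refine ⟨hgm.norm.pow 2, ?_⟩
    have hle : ∀ᵐ ξ₀, ‖‖g ξ₀‖ ^ 2‖ₑ ≤ (∫⁻ ξ, ‖u.hat (ξ₀, ξ)‖ₑ ^ 2) * ∫⁻ ξ, ‖B ξ‖ₑ ^ 2 := by
      filter_upwards [ae_aestronglyMeasurable_slice u.meas] with ξ₀ hm
      rw [enorm_pow, enorm_norm]
      refine le_trans ?_ (lintegral_mul_sq_le hm.enorm hB2.1.enorm)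
      gcongr
      refine (enorm_integral_le_lintegral_enorm _).trans_eq ?_
      simp [enorm_mul]
    refine (lintegral_mono_ae hle).trans_lt ?_
    rw [lintegral_mul_const' _ _ hBfin.ne]
    exact ENNReal.mul_lt_top hUfin hBfin
  refine ae_eq_zero_of_integral_angularInv hg2 fun θ hθ hθs => ?_
  set A : ℝ → ℂ := angularInv fun t => (θ t : ℂ) with hA
  have hA2 : MemLp A 2 := memLp_angularInv hθ hθs
  have hAB : MemLp (fun z : SpaceTime => A z.1 * B z.2) 2 := by
    rw [Measure.volume_eq_prod]
    have hm : AEStronglyMeasurable (fun z : SpaceTime => A z.1 * B z.2)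
      (volume.prod volume) := hA2.1.comp_fst.mul hB2.1.comp_snd
    rw [memLp_two_iff_integrable_sq_norm hm]
    simp only [norm_mul, mul_pow]
    exact ((memLp_two_iff_integrable_sq_norm hA2.1).1 hA2).mul_prod
      ((memLp_two_iff_integrable_sq_norm hB2.1).1 hB2)
  have hint : Integrable fun z : SpaceTime => u.hat z * (A z.1 * B z.2) := hU2.integrable_mul hAB
  set Φ := productTest σ hθ hθs hφ hφs with hΦ
  have hdist : u.dist Φ = 0 := by
    refine u.support Φ ?_
    have hsub : tsupport Φ ⊆ Prod.snd ⁻¹' tsupport φ := by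
      refine closure_minimal (fun z hz => subset_tsupport _ fun h => hz ?_)
        ((isClosed_tsupport φ).preimage continuous_snd)
      rw [hΦ, productTest_apply, h, mul_zero]
    refine Set.disjoint_left.2 fun z hz hz2 => ?_
    exact hφG (hsub hz) hz2.2
  have hl := u.laplace Φ
  rw [hdist, Complex.ofReal_zero, zero_eq_mul] at hl
  have hl := hl.resolve_left (by norm_cast; positivity)
  simp only [hΦ, dualTransform_productTest] at hl
  rw [Measure.volume_eq_prod] at hl hint
  rw [integral_prod _ hint] at hl
  rw [← hl]
  congr 1; ext ξ₀
  rw [← integral_mul_const]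
  congr 1; ext ξ
  ring

/-- The null set of the previous result depends on `φ`, and there are uncountably many `φ`. Their
transforms form a separable subset of `L²`, so a countable dense family suffices, the pairing with
an `L²` slice being continuous. -/
theorem HTilde.ae_forall_integral_slice_eq_zero {σ : ℝ} (hσ : 0 < σ) {G : Set Plane}
    (u : HTilde σ (1 / 2) (1 / 2) G) :
    ∀ᵐ ξ₀ : ℝ, ∀ φ : Plane → ℝ, ContDiff ℝ ∞ φ → HasCompactSupport φ →
      tsupport φ ⊆ (closure G)ᶜ →
      ∫ ξ, u.hat (ξ₀, ξ) * angularInv (fun x => (φ x : ℂ)) ξ = 0 := by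
  have : Fact ((2 : ℝ≥0∞) ≠ ⊤) := ⟨by simp⟩
  let ι := {φ : Plane → ℝ // ContDiff ℝ ∞ φ ∧ HasCompactSupport φ ∧ tsupport φ ⊆ (closure G)ᶜ}
  let F : ι → Lp ℂ 2 (volume : Measure Plane) := fun φ =>
    (memLp_angularInv φ.2.1 φ.2.2.1).toLp _
  obtain ⟨D, hDc, hDd⟩ := TopologicalSpace.exists_countable_dense (Set.range F)
  have hmem : ∀ f : Set.range F, ∃ i : ι, F i = f := fun f => f.2
  choose idx hidx using hmem
  have hall : ∀ᵐ ξ₀ : ℝ, ∀ f ∈ D,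
      ∫ ξ, u.hat (ξ₀, ξ) * angularInv (fun x => ((idx f).1 x : ℂ)) ξ = 0 :=
    (ae_ball_iff hDc).2 fun f _ =>
      u.ae_integral_slice_eq_zero hσ (idx f).2.1 (idx f).2.2.1 (idx f).2.2.2
  filter_upwards [hall, ae_wnormSq_lt_top hσ u.meas u.finite,
    ae_aestronglyMeasurable_slice u.meas] with ξ₀ hD hfin hm φ hφ hφs hφG
  have hV2 := memLp_two_of_wnormSq (freq_ne_zero hσ ξ₀) hm hfin
  have hc2 : MemLp (fun ξ => (starRingEnd ℂ) (u.hat (ξ₀, ξ))) 2 := hV2.star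
  have hin : ∀ i : ι, inner ℂ (hc2.toLp _) (F i) =
      ∫ ξ, u.hat (ξ₀, ξ) * angularInv (fun x => (i.1 x : ℂ)) ξ := fun i => by
    rw [L2.inner_def]
    refine integral_congr_ae ?_
    filter_upwards [hc2.coeFn_toLp, (memLp_angularInv i.2.1 i.2.2.1).coeFn_toLp] with ξ h1 h2
    simp only [F]
    rw [h1, h2]
    simp [mul_comm]
  have hcl : ∀ f : Set.range F, inner ℂ (hc2.toLp _) (f : Lp ℂ 2 (volume : Measure Plane)) = 0 := by
    intro f
    have hclosed : IsClosed {f : Set.range F |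
        inner ℂ (hc2.toLp _) (f : Lp ℂ 2 (volume : Measure Plane)) = 0} :=
      isClosed_eq (by fun_prop) continuous_const
    refine closure_minimal (fun f hf => ?_) hclosed (hDd f)
    change inner ℂ _ _ = _
    rw [← hidx f, hin]
    exact hD f hf
  have := hcl ⟨F ⟨φ, hφ, hφs, hφG⟩, ⟨_, rfl⟩⟩
  rwa [hin] at this

/-- For almost every frequency the slices of an element of `H^{1/2}_σ(ℝ⁺, H̃^{1/2}(G))` are
orthogonal to `H̃^{-1/2}(ℝ² ∖ closure G)`. -/
theorem HTilde.ae_orthogonal {σ : ℝ} (hσ : 0 < σ) {G : Set Plane} (hG : IsOpen G)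
    (hGb : Bornology.IsBounded G) (hL : IsLipschitzSet G) (u : HTilde σ (1 / 2) (1 / 2) G) :
    ∀ᵐ ξ₀ : ℝ, ∀ v : Plane → ℂ, IsTildeHat (-1 / 2) (closure G)ᶜ v →
      Integrable (fun ξ => v ξ * (starRingEnd ℂ) (u.hat (ξ₀, ξ))) ∧
        ∫ ξ, v ξ * (starRingEnd ℂ) (u.hat (ξ₀, ξ)) = 0 := by
  filter_upwards [u.ae_forall_integral_slice_eq_zero hσ, ae_wnormSq_lt_top hσ u.meas u.finite,
    ae_aestronglyMeasurable_slice u.meas] with ξ₀ h0 hfin hm v hv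
  exact integral_tildeHat_mul_conj_eq_zero hG hGb hL (freq_ne_zero hσ ξ₀) hm hfin h0 hv

end FlatContact

namespace FlatContact

/-! ### Bounds for the symbol -/

/-- Lower bound for the real part of a square root of `X² + (P + iA)²`. -/
theorem sqrt_re_bounds {x y X P A : ℝ}
    (h1 : x ^ 2 - y ^ 2 = X ^ 2 + P ^ 2 - A ^ 2) (h2 : x * y = P * A) :
    P ^ 2 * (X ^ 2 + P ^ 2 + A ^ 2) ≤ 2 * (x ^ 2 * (P ^ 2 + A ^ 2)) := by
  have h3 : x ^ 2 * y ^ 2 = P ^ 2 * A ^ 2 := by rw [← mul_pow, h2, mul_pow]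
  -- If `x² < P²`, then `h1` forces `y² < A²`, against `x² y² = P² A²`.
  have hxP : P ^ 2 ≤ x ^ 2 := by
    by_contra! hlt
    have hy : y ^ 2 < A ^ 2 := by nlinarith [sq_nonneg X]
    nlinarith [sq_nonneg x, sq_nonneg y, mul_nonneg (sq_nonneg x) (sub_nonneg.2 hy.le),
      mul_pos (sub_pos.2 hlt) ((sq_nonneg y).trans_lt hy)]
  have h4 : X ^ 2 + P ^ 2 - A ^ 2 ≤ x ^ 2 := by nlinarith [sq_nonneg y]
  nlinarith [mul_le_mul_of_nonneg_right hxP (sq_nonneg A),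
    mul_le_mul_of_nonneg_right h4 (sq_nonneg P), mul_le_mul_of_nonneg_right hxP (sq_nonneg P)]

/-- The symbol `-iμΓ` of the Dirichlet-to-Neumann operator on `Im ω = σ`. -/
noncomputable def dtnSymbol (μ c σ : ℝ) (z : SpaceTime) : ℂ :=
  -Complex.I * μ * gammaSymbol c (freq σ z.1) z.2

theorem dtn_apply (μ c σ : ℝ) (U : SpaceTime → ℂ) (z : SpaceTime) :
    dtn μ c σ U z = dtnSymbol μ c σ z * U z := rfl

/-- Since `-i · i = 1`, the symbol is `μ` times a principal square root, whose real part is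
nonnegative. -/
theorem dtnSymbol_eq (μ c σ : ℝ) (z : SpaceTime) :
    dtnSymbol μ c σ z =
      μ * ((‖z.2‖ ^ 2 : ℝ) - (freq σ z.1 / c) ^ 2 : ℂ) ^ (1 / 2 : ℂ) := by
  rw [dtnSymbol, gammaSymbol]
  linear_combination (-(μ : ℂ) * ((‖z.2‖ ^ 2 : ℝ) - (freq σ z.1 / c) ^ 2 : ℂ) ^ (1 / 2 : ℂ)) *
    Complex.I_mul_I

theorem measurable_dtnSymbol (μ c σ : ℝ) : Measurable (dtnSymbol μ c σ) := by
  have := (continuous_freq σ).measurable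
  have h : dtnSymbol μ c σ = fun z => μ * ((‖z.2‖ ^ 2 : ℝ) - (freq σ z.1 / c) ^ 2 : ℂ) ^ (1 / 2 : ℂ) :=
    funext fun z => dtnSymbol_eq μ c σ z
  rw [h]
  fun_prop

theorem cpow_half_sq (w : ℂ) : (w ^ (1 / 2 : ℂ)) ^ 2 = w := by
  simp

/-- The principal root halves an argument in `(-π, π]`, so the cosine is nonnegative. -/
theorem cpow_half_re_nonneg (w : ℂ) : 0 ≤ (w ^ (1 / 2 : ℂ)).re := by
  by_cases hw : w = 0
  · simp [hw]
  rw [Complex.cpow_def_of_ne_zero hw, Complex.exp_re]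
  refine mul_nonneg (Real.exp_pos _).le (Real.cos_nonneg_of_mem_Icc ?_)
  have h1 := Complex.neg_pi_lt_arg w
  have h2 := Complex.arg_le_pi w
  have : (Complex.log w * (1 / 2)).im = w.arg / 2 := by
    rw [show (1 / 2 : ℂ) = ((1 / 2 : ℝ) : ℂ) by norm_num, Complex.im_mul_ofReal, Complex.log_im]
    ring
  rw [this]
  constructor <;> linarith

theorem norm_freq_sq (σ ξ₀ : ℝ) : ‖freq σ ξ₀‖ ^ 2 = ξ₀ ^ 2 + σ ^ 2 := by
  rw [Complex.sq_norm, Complex.normSq_apply, freq]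
  simp
  ring

theorem stWeight_neg_half (σ : ℝ) (z : SpaceTime) :
    stWeight σ (-1 / 2) (1 / 2) z = ‖freq σ z.1‖⁻¹ * √(‖freq σ z.1‖ ^ 2 + ‖z.2‖ ^ 2) := by
  rw [stWeight, Real.sqrt_eq_rpow, show (2 * (-1 / 2) : ℝ) = -1 by norm_num, Real.rpow_neg_one]

theorem stWeight_half (σ : ℝ) (z : SpaceTime) :
    stWeight σ (1 / 2) (1 / 2) z = ‖freq σ z.1‖ * √(‖freq σ z.1‖ ^ 2 + ‖z.2‖ ^ 2) := by
  rw [stWeight, Real.sqrt_eq_rpow, show (2 * (1 / 2) : ℝ) = 1 by norm_num, Real.rpow_one]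

/-- Lower bound for the real part of the symbol. -/
theorem exists_dtnSymbol_re_ge {μ c σ : ℝ} (hμ : 0 < μ) (hc : 0 < c) (hσ : 0 < σ) :
    ∃ κ : ℝ, 0 < κ ∧ ∀ z, κ * stWeight σ (-1 / 2) (1 / 2) z ≤ (dtnSymbol μ c σ z).re := by
  set m : ℝ := min 1 (1 / c) with hm
  have hmpos : 0 < m := lt_min one_pos (by positivity)
  refine ⟨μ * (σ * m / 2), by positivity, fun z => ?_⟩
  set s : ℂ := ((‖z.2‖ ^ 2 : ℝ) - (freq σ z.1 / c) ^ 2 : ℂ) ^ (1 / 2 : ℂ) with hs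
  have hsq : s ^ 2 = (‖z.2‖ ^ 2 : ℝ) - (freq σ z.1 / c) ^ 2 := cpow_half_sq _
  have hre : 0 ≤ s.re := cpow_half_re_nonneg _
  -- The radicand is `X² + (P + iA)²` with `X = |ξ|`, `P = σ/c`, `A = -ξ₀/c`, because `-iω = σ -
  -- iξ₀`.
  have hval : ((‖z.2‖ ^ 2 : ℝ) - (freq σ z.1 / c) ^ 2 : ℂ) =
      ((‖z.2‖ ^ 2 + (σ / c) ^ 2 - (z.1 / c) ^ 2 : ℝ) : ℂ) +
        ((2 * (σ / c * (-z.1 / c)) : ℝ) : ℂ) * Complex.I := by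
    rw [freq]
    push_cast
    linear_combination (-(σ / c : ℂ) ^ 2) * Complex.I_mul_I
  rw [hval] at hsq
  have e1 := congrArg Complex.re hsq
  have e2 := congrArg Complex.im hsq
  simp only [pow_two, Complex.mul_re, Complex.mul_im, Complex.add_re, Complex.add_im,
    Complex.ofReal_re, Complex.ofReal_im, Complex.I_re, Complex.I_im] at e1 e2
  have hb := sqrt_re_bounds (x := s.re) (y := s.im) (X := ‖z.2‖) (P := σ / c) (A := -z.1 / c)
    (by rw [neg_div, neg_sq]; nlinarith) (by linarith)
  have hω := norm_freq_pos hσ z.1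
  have hω2 := norm_freq_sq σ z.1
  rw [dtnSymbol_eq, ← hs, Complex.re_ofReal_mul, mul_assoc]
  refine mul_le_mul_of_nonneg_left ?_ hμ.le
  rw [stWeight_neg_half, inv_mul_eq_div, mul_div_assoc', div_le_iff₀ hω]
  refine abs_le_of_sq_le_sq' ?_ (by positivity) |>.2
  rw [mul_pow, Real.sq_sqrt (by positivity), mul_pow, hω2, div_pow, mul_pow]
  have hPA : (σ / c) ^ 2 + (-z.1 / c) ^ 2 = (z.1 ^ 2 + σ ^ 2) / c ^ 2 := by
    field_simp; ring
  rw [add_assoc, hPA] at hb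
  have hb2 : σ ^ 2 * (‖z.2‖ ^ 2 + (z.1 ^ 2 + σ ^ 2) / c ^ 2) ≤
      2 * (s.re ^ 2 * (z.1 ^ 2 + σ ^ 2)) := by
    have := mul_le_mul_of_nonneg_right hb (sq_nonneg c)
    calc _ = (σ / c) ^ 2 * (‖z.2‖ ^ 2 + (z.1 ^ 2 + σ ^ 2) / c ^ 2) * c ^ 2 := by field_simp
      _ ≤ _ := this
      _ = _ := by field_simp
  have hm1 : m ^ 2 ≤ 1 := pow_le_one₀ hmpos.le (min_le_left _ _)
  have hm2 : m ^ 2 ≤ 1 / c ^ 2 := by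
    rw [← one_div_pow]; exact pow_le_pow_left₀ hmpos.le (min_le_right _ _) 2
  -- The minimum `m` of `1` and `1/c` compares `|ξ|² + |ω|²/c²` with the weight, in which `c` does
  -- not occur.
  have hb3 : m ^ 2 * (z.1 ^ 2 + σ ^ 2 + ‖z.2‖ ^ 2) ≤
      ‖z.2‖ ^ 2 + (z.1 ^ 2 + σ ^ 2) / c ^ 2 := by
    have i1 := mul_le_mul_of_nonneg_right hm1 (sq_nonneg ‖z.2‖)
    have i2 := mul_le_mul_of_nonneg_right hm2 (by positivity : 0 ≤ z.1 ^ 2 + σ ^ 2)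
    rw [one_div_mul_eq_div] at i2
    nlinarith
  have hb4 := mul_le_mul_of_nonneg_left hb3 (sq_nonneg σ)
  nlinarith [mul_nonneg (sq_nonneg σ) (mul_nonneg (sq_nonneg m)
    (by positivity : 0 ≤ z.1 ^ 2 + σ ^ 2 + ‖z.2‖ ^ 2))]

/-- Upper bound for the symbol. -/
theorem exists_norm_dtnSymbol_le {μ c : ℝ} (σ : ℝ) (hμ : 0 < μ) (hc : 0 < c) :
    ∃ M : ℝ, 0 < M ∧ ∀ z, ‖dtnSymbol μ c σ z‖ ≤ M * √(‖freq σ z.1‖ ^ 2 + ‖z.2‖ ^ 2) := by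
  refine ⟨μ * (1 + 1 / c), by positivity, fun z => ?_⟩
  rw [dtnSymbol_eq, norm_mul, Complex.norm_real, Real.norm_of_nonneg hμ.le, mul_assoc]
  refine mul_le_mul_of_nonneg_left ?_ hμ.le
  refine abs_le_of_sq_le_sq' ?_ (by positivity) |>.2
  rw [← norm_pow, cpow_half_sq, mul_pow, Real.sq_sqrt (by positivity)]
  refine (norm_sub_le _ _).trans ?_
  rw [Complex.norm_real, Real.norm_of_nonneg (by positivity), norm_pow, norm_div,
    Complex.norm_real, Real.norm_of_nonneg hc.le, div_pow]
  have h1 : 1 ≤ (1 + 1 / c) ^ 2 := one_le_pow₀ (by linarith [one_div_pos.2 hc])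
  have h2 : 1 / c ^ 2 ≤ (1 + 1 / c) ^ 2 := by
    rw [← one_div_pow]; exact pow_le_pow_left₀ (by positivity) (by linarith) 2
  have i1 := mul_le_mul_of_nonneg_right h1 (sq_nonneg ‖z.2‖)
  have i2 := mul_le_mul_of_nonneg_right h2 (sq_nonneg ‖freq σ z.1‖)
  rw [one_div_mul_eq_div] at i2
  nlinarith

end FlatContact

/-! ### Finite energy, and the bilinear estimates. -/

namespace FlatContact

/-- Transforms with finite norm `‖·‖_{1/2,1/2,σ,*}`. -/
structure FiniteEnergy (σ : ℝ) (U : SpaceTime → ℂ) : Prop where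
  meas : AEStronglyMeasurable U volume
  finite : stNorm σ (1 / 2) (1 / 2) U < ⊤

theorem HTilde.finiteEnergy {σ : ℝ} {G : Set Plane} (u : HTilde σ (1 / 2) (1 / 2) G) :
    FiniteEnergy σ u.hat := ⟨u.meas, u.finite⟩

theorem lt_of_pow_two_lt_top {a : ℝ≥0∞} (h : a ^ 2 < ⊤) : a < ⊤ :=
  lt_top_iff_ne_top.2 fun h' => by simp [h'] at h

theorem FiniteEnergy.sub {σ : ℝ} {U V : SpaceTime → ℂ}
    (hU : FiniteEnergy σ U) (hV : FiniteEnergy σ V) : FiniteEnergy σ (U - V) := by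
  refine ⟨hU.meas.sub hV.meas, ?_⟩
  have h1 := stNorm_sq_lt_top hU.finite
  have h2 := stNorm_sq_lt_top hV.finite
  rw [stNorm_sq_eq _ _ hU.meas] at h1
  rw [stNorm_sq_eq _ _ hV.meas] at h2
  have h3 : stNorm σ (1 / 2) (1 / 2) (U - V) ^ 2 < ⊤ := by
    rw [stNorm_sq_eq _ _ (hU.meas.sub hV.meas)]
    have hle : ∀ z, ENNReal.ofReal (stWeight σ (1 / 2) (1 / 2) z) * ‖(U - V) z‖ₑ ^ 2 ≤
        4 * (ENNReal.ofReal (stWeight σ (1 / 2) (1 / 2) z) * ‖U z‖ₑ ^ 2 +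
          ENNReal.ofReal (stWeight σ (1 / 2) (1 / 2) z) * ‖V z‖ₑ ^ 2) := fun z => by
      rw [← mul_add, mul_left_comm]
      gcongr
      exact (pow_le_pow_left' enorm_sub_le 2).trans (add_sq_le_four_mul _ _)
    refine (lintegral_mono hle).trans_lt ?_
    rw [lintegral_const_mul' _ _ (by simp), lintegral_add_left' (by
      exact (measurable_stWeight _ _ _).ennreal_ofReal.aemeasurable.mul (hU.meas.enorm.pow_const 2))]
    exact ENNReal.mul_lt_top (by simp) (ENNReal.add_lt_top.2 ⟨h1, h2⟩)
  exact lt_of_pow_two_lt_top h3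

/-- Norms with a smaller power of the frequency are finite. -/
theorem FiniteEnergy.stNorm_lt_top {σ : ℝ} (hσ : 0 < σ) {U : SpaceTime → ℂ}
    (hU : FiniteEnergy σ U) {s : ℝ} (hs : s ≤ 1 / 2) : stNorm σ s (1 / 2) U < ⊤ := by
  have h1 := stNorm_sq_lt_top hU.finite
  rw [stNorm_sq_eq _ _ hU.meas] at h1
  have h3 : stNorm σ s (1 / 2) U ^ 2 < ⊤ := by
    rw [stNorm_sq_eq _ _ hU.meas]
    have hle : ∀ z, ENNReal.ofReal (stWeight σ s (1 / 2) z) * ‖U z‖ₑ ^ 2 ≤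
        ENNReal.ofReal (σ ^ (2 * s - 1)) *
          (ENNReal.ofReal (stWeight σ (1 / 2) (1 / 2) z) * ‖U z‖ₑ ^ 2) := fun z => by
      rw [← mul_assoc, ← ENNReal.ofReal_mul (by positivity)]
      gcongr
      rw [stWeight, stWeight, ← mul_assoc]
      gcongr
      have hω := norm_freq_pos hσ z.1
      -- The surplus power `‖ω‖^(2s-1)` has a nonpositive exponent, so it is largest at the minimal
      -- modulus `σ`.
      rw [show 2 * s = (2 * s - 1) + 2 * (1 / 2) by ring, Real.rpow_add hω]
      gcongr ?_ * _
      rw [show 2 * s - 1 + 2 * (1 / 2) - 1 = 2 * s - 1 by ring]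
      exact Real.rpow_le_rpow_of_nonpos hσ (le_norm_freq _) (by linarith)
    refine (lintegral_mono hle).trans_lt ?_
    rw [lintegral_const_mul' _ _ ENNReal.ofReal_ne_top]
    exact ENNReal.mul_lt_top ENNReal.ofReal_lt_top h1
  exact lt_of_pow_two_lt_top h3

/-! ### The form of the Dirichlet-to-Neumann operator -/

/-- Continuity of the form of the Dirichlet-to-Neumann operator. -/
theorem lintegral_dtn_mul_le {μ c σ M : ℝ} (hσ : 0 < σ)
    (hM : ∀ z, ‖dtnSymbol μ c σ z‖ ≤ M * √(‖freq σ z.1‖ ^ 2 + ‖z.2‖ ^ 2)) {U V : SpaceTime → ℂ}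
    (hU : AEStronglyMeasurable U volume) (hV : AEStronglyMeasurable V volume) :
    ∫⁻ z, ‖dtn μ c σ U z * (starRingEnd ℂ) (V z)‖ₑ ≤
      ENNReal.ofReal M * (stNorm σ (-1 / 2) (1 / 2) U * stNorm σ (1 / 2) (1 / 2) V) := by
  have hw : ∀ s, Measurable fun z => ENNReal.ofReal √(stWeight σ s (1 / 2) z) := fun s =>
    (measurable_stWeight σ s (1 / 2)).sqrt.ennreal_ofReal
  set f : SpaceTime → ℝ≥0∞ := fun z => ENNReal.ofReal √(stWeight σ (-1 / 2) (1 / 2) z) * ‖U z‖ₑ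
  set g : SpaceTime → ℝ≥0∞ := fun z => ENNReal.ofReal √(stWeight σ (1 / 2) (1 / 2) z) * ‖V z‖ₑ
  have hpt : ∀ z, ‖dtn μ c σ U z * (starRingEnd ℂ) (V z)‖ₑ ≤ ENNReal.ofReal M * (f z * g z) := by
    intro z
    have hω := norm_freq_pos hσ z.1
    -- The powers `|ω|^{-1}` and `|ω|` of the two weights cancel, leaving exactly the growth of the
    -- symbol.
    have hprod : √(stWeight σ (-1 / 2) (1 / 2) z) * √(stWeight σ (1 / 2) (1 / 2) z) =
        √(‖freq σ z.1‖ ^ 2 + ‖z.2‖ ^ 2) := by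
      rw [← Real.sqrt_mul (stWeight_pos hσ _ _ z).le, stWeight_neg_half, stWeight_half]
      rw [mul_mul_mul_comm, inv_mul_cancel₀ hω.ne', one_mul, Real.sqrt_mul_self (by positivity)]
    calc ‖dtn μ c σ U z * (starRingEnd ℂ) (V z)‖ₑ
        = ENNReal.ofReal ‖dtnSymbol μ c σ z‖ * (‖U z‖ₑ * ‖V z‖ₑ) := by
          rw [dtn_apply, enorm_mul, enorm_mul, RCLike.enorm_conj, ofReal_norm, mul_assoc]
      _ ≤ ENNReal.ofReal (M * √(‖freq σ z.1‖ ^ 2 + ‖z.2‖ ^ 2)) * (‖U z‖ₑ * ‖V z‖ₑ) := by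
          gcongr
          exact hM z
      _ = ENNReal.ofReal M * (f z * g z) := by
          rw [ENNReal.ofReal_mul' (by positivity), ← hprod, ENNReal.ofReal_mul (by positivity)]
          simp only [f, g]
          ring
  have hsq : ∀ (s : ℝ) (W : SpaceTime → ℂ), AEStronglyMeasurable W volume →
      ∫⁻ z, (ENNReal.ofReal √(stWeight σ s (1 / 2) z) * ‖W z‖ₑ) ^ 2 =
        stNorm σ s (1 / 2) W ^ 2 := fun s W hW => by
    rw [stNorm_sq_eq _ _ hW]
    congr 1; ext z
    rw [mul_pow, ← ENNReal.ofReal_pow (by positivity), Real.sq_sqrt (stWeight_pos hσ _ _ z).le]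
  have hcs := lintegral_mul_sq_le (μ := volume) (f := f) (g := g)
    ((hw _).aemeasurable.mul hU.enorm) ((hw _).aemeasurable.mul hV.enorm)
  rw [hsq _ U hU, hsq _ V hV, ← mul_pow] at hcs
  refine (lintegral_mono hpt).trans ?_
  rw [lintegral_const_mul' _ _ ENNReal.ofReal_ne_top]
  gcongr
  exact (ENNReal.pow_le_pow_left_iff (by norm_num)).1 hcs

section Form

variable {μ c σ : ℝ}

theorem FiniteEnergy.integrable_dtn_mul (hμ : 0 < μ) (hc : 0 < c) (hσ : 0 < σ)
    {U V : SpaceTime → ℂ} (hU : FiniteEnergy σ U) (hV : FiniteEnergy σ V) :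
    Integrable fun z => dtn μ c σ U z * (starRingEnd ℂ) (V z) := by
  obtain ⟨M, hM0, hM⟩ := exists_norm_dtnSymbol_le σ hμ hc
  refine ⟨?_, (lintegral_dtn_mul_le hσ hM hU.meas hV.meas).trans_lt ?_⟩
  · exact ((measurable_dtnSymbol μ c σ).aestronglyMeasurable.mul hU.meas).mul hV.meas.star
  · exact ENNReal.mul_lt_top ENNReal.ofReal_lt_top
      (ENNReal.mul_lt_top (hU.stNorm_lt_top hσ (by norm_num)) hV.finite)

/-- Integrability on space-time lets Fubini replace the iterated integral by a single one. -/
theorem pairing_dtn_eq (hμ : 0 < μ) (hc : 0 < c) (hσ : 0 < σ)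
    {U V : SpaceTime → ℂ} (hU : FiniteEnergy σ U) (hV : FiniteEnergy σ V) :
    pairing (dtn μ c σ U) V =
      ((2 * Real.pi) ^ 3)⁻¹ * (∫ z, dtn μ c σ U z * (starRingEnd ℂ) (V z)).re := by
  have h := hU.integrable_dtn_mul hμ hc hσ hV
  rw [Measure.volume_eq_prod] at h
  rw [pairing, Measure.volume_eq_prod, integral_prod _ h]

theorem pairing_dtn_sub_left (hμ : 0 < μ) (hc : 0 < c) (hσ : 0 < σ)
    {U V W : SpaceTime → ℂ} (hU : FiniteEnergy σ U) (hV : FiniteEnergy σ V)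
    (hW : FiniteEnergy σ W) :
    pairing (dtn μ c σ (U - V)) W = pairing (dtn μ c σ U) W - pairing (dtn μ c σ V) W := by
  rw [pairing_dtn_eq hμ hc hσ (hU.sub hV) hW, pairing_dtn_eq hμ hc hσ hU hW,
    pairing_dtn_eq hμ hc hσ hV hW, ← mul_sub, ← Complex.sub_re,
    ← integral_sub (hU.integrable_dtn_mul hμ hc hσ hW) (hV.integrable_dtn_mul hμ hc hσ hW)]
  congr 3; ext z
  simp only [dtn_apply, Pi.sub_apply]
  ring

theorem pairing_dtn_sub_right (hμ : 0 < μ) (hc : 0 < c) (hσ : 0 < σ)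
    {U V W : SpaceTime → ℂ} (hU : FiniteEnergy σ U) (hV : FiniteEnergy σ V)
    (hW : FiniteEnergy σ W) :
    pairing (dtn μ c σ U) (V - W) = pairing (dtn μ c σ U) V - pairing (dtn μ c σ U) W := by
  rw [pairing_dtn_eq hμ hc hσ hU (hV.sub hW), pairing_dtn_eq hμ hc hσ hU hV,
    pairing_dtn_eq hμ hc hσ hU hW, ← mul_sub, ← Complex.sub_re,
    ← integral_sub (hU.integrable_dtn_mul hμ hc hσ hV) (hU.integrable_dtn_mul hμ hc hσ hW)]
  congr 3; ext z
  simp only [Pi.sub_apply, map_sub]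
  ring

theorem ofReal_pairing_dtn_le (hμ : 0 < μ) (hc : 0 < c) (hσ : 0 < σ) {M : ℝ}
    (hM : ∀ z, ‖dtnSymbol μ c σ z‖ ≤ M * √(‖freq σ z.1‖ ^ 2 + ‖z.2‖ ^ 2)) {U V : SpaceTime → ℂ}
    (hU : FiniteEnergy σ U) (hV : FiniteEnergy σ V) :
    ENNReal.ofReal ((2 * Real.pi) ^ 3 * pairing (dtn μ c σ U) V) ≤
      ENNReal.ofReal M * (stNorm σ (-1 / 2) (1 / 2) U * stNorm σ (1 / 2) (1 / 2) V) := by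
  rw [pairing_dtn_eq hμ hc hσ hU hV, mul_inv_cancel_left₀ (by positivity)]
  refine le_trans ?_ (lintegral_dtn_mul_le hσ hM hU.meas hV.meas)
  refine le_trans ?_ (enorm_integral_le_lintegral_enorm _)
  rw [← ofReal_norm]
  exact ENNReal.ofReal_le_ofReal (Complex.re_le_norm _)

/-- Coercivity of the form of the Dirichlet-to-Neumann operator. -/
theorem stNorm_sq_le_pairing_dtn (hμ : 0 < μ) (hc : 0 < c) (hσ : 0 < σ) {κ : ℝ} (hκ : 0 < κ)
    (hS : ∀ z, κ * stWeight σ (-1 / 2) (1 / 2) z ≤ (dtnSymbol μ c σ z).re) {U : SpaceTime → ℂ}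
    (hU : FiniteEnergy σ U) :
    ENNReal.ofReal κ * stNorm σ (-1 / 2) (1 / 2) U ^ 2 ≤
      ENNReal.ofReal ((2 * Real.pi) ^ 3 * pairing (dtn μ c σ U) U) := by
  have hint := hU.integrable_dtn_mul hμ hc hσ hU
  have hre : ∀ z, (dtn μ c σ U z * (starRingEnd ℂ) (U z)).re =
      (dtnSymbol μ c σ z).re * ‖U z‖ ^ 2 := fun z => by
    rw [dtn_apply, mul_assoc, Complex.mul_conj, Complex.re_mul_ofReal, Complex.normSq_eq_norm_sq]
  have hintre : Integrable fun z => (dtnSymbol μ c σ z).re * ‖U z‖ ^ 2 := by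
    have := hint.re
    simpa only [RCLike.re_eq_complex_re, hre] using this
  have hpos : ∀ z, 0 ≤ (dtnSymbol μ c σ z).re := fun z =>
    (mul_nonneg hκ.le (stWeight_pos hσ _ _ z).le).trans (hS z)
  rw [pairing_dtn_eq hμ hc hσ hU hU, mul_inv_cancel_left₀ (by positivity)]
  have hre2 : (∫ z, dtn μ c σ U z * (starRingEnd ℂ) (U z)).re =
      ∫ z, (dtnSymbol μ c σ z).re * ‖U z‖ ^ 2 := by
    rw [← RCLike.re_eq_complex_re, ← integral_re hint]
    simp only [RCLike.re_eq_complex_re, hre]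
  rw [hre2, ofReal_integral_eq_lintegral_ofReal hintre
    (Filter.Eventually.of_forall fun z => mul_nonneg (hpos z) (sq_nonneg _)),
    stNorm_sq_eq _ _ hU.meas, ← lintegral_const_mul' _ _ ENNReal.ofReal_ne_top]
  refine lintegral_mono fun z => ?_
  rw [← mul_assoc, ← ENNReal.ofReal_mul hκ.le, ENNReal.ofReal_mul (hpos z),
    ENNReal.ofReal_pow (norm_nonneg _), ofReal_norm]
  gcongr
  exact hS z

end Form

/-! ### The pairing with `H^s_σ(ℝ⁺, H^{-1/2}(G))` -/

/-- The slice pairing is bounded by the quotient norm, if the second argument is orthogonal to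
`H̃^{-1/2}(ℝ² ∖ closure G)`. -/
theorem enorm_sq_slice_pairing_le {ω : ℂ} (hω : ω ≠ 0) {G : Set Plane} {F V : Plane → ℂ}
    (hF : AEStronglyMeasurable F) (hV : AEStronglyMeasurable V)
    (hFV : Integrable fun ξ => F ξ * (starRingEnd ℂ) (V ξ))
    (hort : ∀ v : Plane → ℂ, IsTildeHat (-1 / 2) (closure G)ᶜ v →
      Integrable (fun ξ => v ξ * (starRingEnd ℂ) (V ξ)) ∧
        ∫ ξ, v ξ * (starRingEnd ℂ) (V ξ) = 0) :
    ‖∫ ξ, F ξ * (starRingEnd ℂ) (V ξ)‖ₑ ^ 2 / wnormSq (1 / 2) ω V ≤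
      quotNormSq (-1 / 2) ω G F := by
  -- With the norm of `V` divided out, each representative `F + v` can be tested separately: adding
  -- `v` leaves the integral unchanged, and Cauchy-Schwarz applies.
  refine le_iInf₂ fun v hv => ENNReal.div_le_of_le_mul ?_
  obtain ⟨hi, h0⟩ := hort v hv
  have hpos : 0 < ‖ω‖ := norm_pos_iff.2 hω
  have heq : ∫ ξ, F ξ * (starRingEnd ℂ) (V ξ) = ∫ ξ, (F + v) ξ * (starRingEnd ℂ) (V ξ) := by
    simp only [Pi.add_apply, add_mul]
    rw [integral_add hFV hi, h0, add_zero]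
  have hk : ∀ a : ℝ, Measurable fun ξ : Plane =>
      ENNReal.ofReal ((‖ω‖ ^ 2 + ‖ξ‖ ^ 2) ^ a) := fun a => by fun_prop
  have hsq : ∀ (a : ℝ) (W : Plane → ℂ),
      ∫⁻ ξ, (ENNReal.ofReal ((‖ω‖ ^ 2 + ‖ξ‖ ^ 2) ^ (a / 2)) * ‖W ξ‖ₑ) ^ 2 = wnormSq a ω W := by
    intro a W
    rw [wnormSq]
    congr 1; ext ξ
    rw [mul_pow, ← ENNReal.ofReal_pow (by positivity), ← Real.rpow_natCast,
      ← Real.rpow_mul (by positivity)]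
    norm_num
  rw [heq, ← hsq, ← hsq]
  refine le_trans ?_ (lintegral_mul_sq_le ((hk _).aemeasurable.mul (hF.add hv.meas).enorm)
    ((hk _).aemeasurable.mul hV.enorm))
  gcongr
  refine (enorm_integral_le_lintegral_enorm _).trans_eq ?_
  congr 1; ext ξ
  rw [mul_mul_mul_comm, ← ENNReal.ofReal_mul (by positivity), ← Real.rpow_add (by positivity)]
  norm_num [enorm_mul, RCLike.enorm_conj]

theorem integrable_slice_pairing {ω : ℂ} (hω : ω ≠ 0) {F V : Plane → ℂ}
    (hF : AEStronglyMeasurable F) (hV : AEStronglyMeasurable V)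
    (hFf : wnormSq (-1 / 2) ω F < ⊤) (hVf : wnormSq (1 / 2) ω V < ⊤) :
    Integrable fun ξ => F ξ * (starRingEnd ℂ) (V ξ) := by
  have hpos : 0 < ‖ω‖ := norm_pos_iff.2 hω
  have hb : ∀ ξ : Plane, 0 < (‖ω‖ ^ 2 + ‖ξ‖ ^ 2) ^ (1 / 2 : ℝ) := fun ξ => by positivity
  refine integrable_mul_of_weight
    (k := fun ξ : Plane => ENNReal.ofReal ((‖ω‖ ^ 2 + ‖ξ‖ ^ 2) ^ (1 / 2 : ℝ)))
    (by fun_prop) (fun ξ => by simpa using hb ξ) (fun _ => ENNReal.ofReal_ne_top) hF hV.star ?_ ?_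
  · refine lt_of_eq_of_lt ?_ hFf
    rw [wnormSq]
    congr 1; ext ξ
    rw [← ENNReal.ofReal_inv_of_pos (hb ξ), ← Real.rpow_neg (by positivity), neg_div]
  · refine lt_of_eq_of_lt ?_ hVf
    simp only [RCLike.enorm_conj]
    rfl

theorem aestronglyMeasurable_slice_pairing {F V : SpaceTime → ℂ}
    (hF : AEStronglyMeasurable F volume) (hV : AEStronglyMeasurable V volume) :
    AEStronglyMeasurable fun ξ₀ : ℝ => ∫ ξ : Plane, F (ξ₀, ξ) * (starRingEnd ℂ) (V (ξ₀, ξ)) := by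
  rw [Measure.volume_eq_prod] at hF hV
  exact (hF.mul hV.star).integral_prod_right'

/-- Continuity of the pairing. -/
theorem lintegral_slice_pairing_le {σ : ℝ} (hσ : 0 < σ) {s : ℝ} {G : Set Plane}
    {F V : SpaceTime → ℂ} (hF : AEStronglyMeasurable F volume)
    (hV : AEStronglyMeasurable V volume) (hVf : stNorm σ (-s) (1 / 2) V < ⊤)
    (hFV : ∀ᵐ ξ₀ : ℝ, Integrable fun ξ : Plane => F (ξ₀, ξ) * (starRingEnd ℂ) (V (ξ₀, ξ)))
    (hort : ∀ᵐ ξ₀ : ℝ, ∀ v : Plane → ℂ, IsTildeHat (-1 / 2) (closure G)ᶜ v →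
      Integrable (fun ξ => v ξ * (starRingEnd ℂ) (V (ξ₀, ξ))) ∧
        ∫ ξ, v ξ * (starRingEnd ℂ) (V (ξ₀, ξ)) = 0) :
    ∫⁻ ξ₀ : ℝ, ‖∫ ξ : Plane, F (ξ₀, ξ) * (starRingEnd ℂ) (V (ξ₀, ξ))‖ₑ ≤
      stQuotNorm σ s (-1 / 2) G F * stNorm σ (-s) (1 / 2) V := by
  set J : ℝ → ℂ := fun ξ₀ => ∫ ξ : Plane, F (ξ₀, ξ) * (starRingEnd ℂ) (V (ξ₀, ξ)) with hJ
  have hJm : AEStronglyMeasurable J := aestronglyMeasurable_slice_pairing hF hV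
  set N : ℝ → ℝ≥0∞ := fun ξ₀ => wnormSq (1 / 2) (freq σ ξ₀) (fun ξ => V (ξ₀, ξ)) with hN
  have hNm : AEMeasurable N := by
    have hm : AEMeasurable (fun z : SpaceTime => ENNReal.ofReal
        ((‖freq σ z.1‖ ^ 2 + ‖z.2‖ ^ 2) ^ (1 / 2 : ℝ)) * ‖V z‖ₑ ^ 2) (volume.prod volume) := by
      have := (continuous_freq σ).measurable
      rw [← Measure.volume_eq_prod]
      exact (Measurable.aemeasurable (by fun_prop)).mul (hV.enorm.pow_const 2)
    exact hm.lintegral_prod_right'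
  have hfm : Measurable fun ξ₀ => ‖freq σ ξ₀‖ := (continuous_freq σ).norm.measurable
  -- The quotient norm is an infimum over an uncountable family, with no measurability in `ξ₀`
  -- available. Cauchy-Schwarz is therefore applied to the measurable `|J| / N^{1/2}`, and the
  -- quotient norm enters only afterwards, by monotonicity.
  set f : ℝ → ℝ≥0∞ := fun ξ₀ => ENNReal.ofReal (‖freq σ ξ₀‖ ^ s) * (‖J ξ₀‖ₑ / N ξ₀ ^ (1 / 2 : ℝ))
  set g : ℝ → ℝ≥0∞ := fun ξ₀ => ENNReal.ofReal (‖freq σ ξ₀‖ ^ (-s)) * N ξ₀ ^ (1 / 2 : ℝ)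
  have hsqrt : ∀ a : ℝ≥0∞, (a ^ (1 / 2 : ℝ)) ^ 2 = a := fun a => by
    rw [← ENNReal.rpow_two, ← ENNReal.rpow_mul]; norm_num
  have hweight : ∀ (a ξ₀ : ℝ), ENNReal.ofReal (‖freq σ ξ₀‖ ^ a) ^ 2 =
      ENNReal.ofReal (‖freq σ ξ₀‖ ^ (2 * a)) := fun a ξ₀ => by
    rw [← ENNReal.ofReal_pow (by positivity), ← Real.rpow_natCast, ← Real.rpow_mul (by positivity)]
    congr 2
    push_cast
    ring
  have hslice : ∀ᵐ ξ₀, ‖J ξ₀‖ₑ ^ 2 / N ξ₀ ≤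
      quotNormSq (-1 / 2) (freq σ ξ₀) G (fun ξ => F (ξ₀, ξ)) := by
    filter_upwards [hFV, hort, ae_aestronglyMeasurable_slice hF,
      ae_aestronglyMeasurable_slice hV] with ξ₀ h1 h2 h3 h4
    exact enorm_sq_slice_pairing_le (freq_ne_zero hσ ξ₀) h3 h4 h1 h2
  have hJN : ∀ᵐ ξ₀, ‖J ξ₀‖ₑ = f ξ₀ * g ξ₀ := by
    filter_upwards [ae_wnormSq_lt_top hσ hV hVf, ae_aestronglyMeasurable_slice hV] with ξ₀ hfin hm
    have hpos := norm_freq_pos hσ ξ₀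
    have hw : ENNReal.ofReal (‖freq σ ξ₀‖ ^ s) * ENNReal.ofReal (‖freq σ ξ₀‖ ^ (-s)) = 1 := by
      rw [← ENNReal.ofReal_mul (by positivity), ← Real.rpow_add hpos]
      simp
    change _ = (_ * _) * (_ * _)
    rw [mul_mul_mul_comm, hw, one_mul]
    -- Where `N` vanishes so does the slice of `V`, hence `J`; elsewhere `N` is finite and cancels.
    by_cases h0 : N ξ₀ = 0
    · have hV0 : ∀ᵐ ξ, V (ξ₀, ξ) = 0 := by
        have hmeas : AEMeasurable fun ξ : Plane => ENNReal.ofReal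
            ((‖freq σ ξ₀‖ ^ 2 + ‖ξ‖ ^ 2) ^ (1 / 2 : ℝ)) * ‖V (ξ₀, ξ)‖ₑ ^ 2 :=
          (Measurable.aemeasurable (by fun_prop)).mul (hm.enorm.pow_const 2)
        filter_upwards [(lintegral_eq_zero_iff' hmeas).1 h0] with ξ hξ
        have hb : 0 < (‖freq σ ξ₀‖ ^ 2 + ‖ξ‖ ^ 2) ^ (1 / 2 : ℝ) := by positivity
        have hne : ENNReal.ofReal ((‖freq σ ξ₀‖ ^ 2 + ‖ξ‖ ^ 2) ^ (1 / 2 : ℝ)) ≠ 0 := by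
          simpa using hb
        rw [Pi.zero_apply, mul_eq_zero] at hξ
        simpa using hξ.resolve_left hne
      have : J ξ₀ = 0 := by
        rw [hJ]; simp only
        rw [integral_congr_ae (g := fun _ => 0) (hV0.mono fun ξ hξ => by simp [hξ])]
        simp
      simp [this]
    · rw [ENNReal.div_mul_cancel]
      · simp [h0]
      · exact ENNReal.rpow_ne_top_of_nonneg (by norm_num) hfin.ne
  have hcs := lintegral_mul_sq_le (μ := volume) (f := f) (g := g)
    ((hfm.pow_const s).ennreal_ofReal.aemeasurable.mul (hJm.enorm.div (hNm.pow_const _)))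
    ((hfm.pow_const (-s)).ennreal_ofReal.aemeasurable.mul (hNm.pow_const _))
  have hf2 : ∫⁻ ξ₀, f ξ₀ ^ 2 ≤ stQuotNorm σ s (-1 / 2) G F ^ 2 := by
    rw [stQuotNorm, hsqrt]
    refine lintegral_mono_ae ?_
    filter_upwards [hslice] with ξ₀ h
    rw [mul_pow, hweight, div_eq_mul_inv, mul_pow, ← ENNReal.inv_pow, hsqrt, ← div_eq_mul_inv]
    gcongr
  have hg2 : ∫⁻ ξ₀, g ξ₀ ^ 2 = stNorm σ (-s) (1 / 2) V ^ 2 := by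
    rw [stNorm, hsqrt]
    congr 1; ext ξ₀
    rw [mul_pow, hweight, hsqrt]
  rw [lintegral_congr_ae hJN]
  refine (ENNReal.pow_le_pow_left_iff (n := 2) (by norm_num)).1 ?_
  rw [mul_pow]
  refine hcs.trans ?_
  rw [hg2]
  gcongr

end FlatContact

/-! ### The load, the residual and the final estimate. -/

namespace FlatContact

section Final

variable {μ c σ : ℝ}

/-- Conformity of the discretisation: it makes the discrete solution a competitor in the continuous
inequality. -/
theorem discreteCone_subset_nonnegCone {G : Set Plane} (𝒯 : Triangulation G) (Δt : ℝ) (N : ℕ∞)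
    (p q : ℕ) : discreteCone σ 𝒯 Δt N p q ⊆ nonnegCone σ (1 / 2) (1 / 2) G := by
  rintro w ⟨F, -, hF, hw⟩ φ hφ
  rw [hw]
  exact integral_nonneg fun z => mul_nonneg (hF z) (hφ z)

section Load

variable {G : Opens Plane} (hσ : 0 < σ) (hGb : Bornology.IsBounded (G : Set Plane))
  (hL : IsLipschitzSet (G : Set Plane)) (h : HQuot σ (3 / 2) (-1 / 2) G)

include hσ

theorem HQuot.ae_integrable_slice {V : SpaceTime → ℂ} (hV : FiniteEnergy σ V) :
    ∀ᵐ ξ₀ : ℝ, Integrable fun ξ : Plane => h.hat (ξ₀, ξ) * (starRingEnd ℂ) (V (ξ₀, ξ)) := by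
  filter_upwards [h.slices, ae_aestronglyMeasurable_slice h.meas,
    ae_aestronglyMeasurable_slice hV.meas, ae_wnormSq_lt_top hσ hV.meas hV.finite]
    with ξ₀ h1 h2 h3 h4
  exact integrable_slice_pairing (freq_ne_zero hσ ξ₀) h2 h3 h1 h4

include hGb hL

/-- Only the quotient norm of `h` is integrable over frequencies, not the norm of its
representatives, so orthogonality is needed even for the pairing to converge. -/
theorem HQuot.integrable_pairing (u : HTilde σ (1 / 2) (1 / 2) (G : Set Plane)) :
    Integrable fun ξ₀ : ℝ => ∫ ξ : Plane, h.hat (ξ₀, ξ) * (starRingEnd ℂ) (u.hat (ξ₀, ξ)) := by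
  have hu := u.finiteEnergy
  have hf : stNorm σ (-(3 / 2)) (1 / 2) u.hat < ⊤ := hu.stNorm_lt_top hσ (by norm_num)
  refine ⟨aestronglyMeasurable_slice_pairing h.meas u.meas, ?_⟩
  refine (lintegral_slice_pairing_le hσ h.meas u.meas hf (h.ae_integrable_slice hσ hu)
    (u.ae_orthogonal hσ G.isOpen hGb hL)).trans_lt ?_
  exact ENNReal.mul_lt_top h.finite hf

theorem HQuot.pairing_sub (u v : HTilde σ (1 / 2) (1 / 2) (G : Set Plane)) :
    pairing h.hat (u.hat - v.hat) = pairing h.hat u.hat - pairing h.hat v.hat := by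
  rw [pairing, pairing, pairing, ← mul_sub, ← Complex.sub_re,
    ← integral_sub (h.integrable_pairing hσ hGb hL u) (h.integrable_pairing hσ hGb hL v)]
  congr 2
  refine integral_congr_ae ?_
  filter_upwards [h.ae_integrable_slice hσ u.finiteEnergy,
    h.ae_integrable_slice hσ v.finiteEnergy] with ξ₀ h1 h2
  rw [← integral_sub h1 h2]
  congr 1; ext ξ
  simp only [Pi.sub_apply, map_sub]
  ring

/-- The residual `h - p_Q S_σ u` is controlled by its quotient norm. -/
theorem HQuot.ofReal_residual_le (hμ : 0 < μ) (hc : 0 < c)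
    (u v w : HTilde σ (1 / 2) (1 / 2) (G : Set Plane)) :
    ENNReal.ofReal ((2 * Real.pi) ^ 3 * ((pairing h.hat v.hat - pairing h.hat w.hat) -
      pairing (dtn μ c σ u.hat) (v.hat - w.hat))) ≤
      stQuotNorm σ (1 / 2) (-1 / 2) (G : Set Plane) (h.hat - dtn μ c σ u.hat) *
        stNorm σ (-1 / 2) (1 / 2) (v.hat - w.hat) := by
  set V : SpaceTime → ℂ := v.hat - w.hat with hV
  have hVE : FiniteEnergy σ V := v.finiteEnergy.sub w.finiteEnergy
  have huE := u.finiteEnergy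
  have hint := huE.integrable_dtn_mul hμ hc hσ hVE
  have hdm : AEStronglyMeasurable (dtn μ c σ u.hat) volume :=
    (measurable_dtnSymbol μ c σ).aestronglyMeasurable.mul u.meas
  have hort : ∀ᵐ ξ₀ : ℝ, ∀ f : Plane → ℂ, IsTildeHat (-1 / 2) (closure (G : Set Plane))ᶜ f →
      Integrable (fun ξ => f ξ * (starRingEnd ℂ) (V (ξ₀, ξ))) ∧
        ∫ ξ, f ξ * (starRingEnd ℂ) (V (ξ₀, ξ)) = 0 := by
    filter_upwards [v.ae_orthogonal hσ G.isOpen hGb hL, w.ae_orthogonal hσ G.isOpen hGb hL]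
      with ξ₀ h1 h2 f hf
    obtain ⟨i1, e1⟩ := h1 f hf
    obtain ⟨i2, e2⟩ := h2 f hf
    simp only [hV, Pi.sub_apply, map_sub, mul_sub]
    exact ⟨i1.sub i2, by rw [integral_sub i1 i2, e1, e2, sub_zero]⟩
  rw [Measure.volume_eq_prod] at hint
  have hsl1 := h.ae_integrable_slice hσ hVE
  have hsl2 := hint.prod_right_ae
  have hsplit : ∀ ξ₀ ξ, (h.hat - dtn μ c σ u.hat) (ξ₀, ξ) * (starRingEnd ℂ) (V (ξ₀, ξ)) =
      h.hat (ξ₀, ξ) * (starRingEnd ℂ) (V (ξ₀, ξ)) -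
        dtn μ c σ u.hat (ξ₀, ξ) * (starRingEnd ℂ) (V (ξ₀, ξ)) := fun ξ₀ ξ => by
    rw [Pi.sub_apply, sub_mul]
  have hFV : ∀ᵐ ξ₀ : ℝ, Integrable fun ξ : Plane =>
      (h.hat - dtn μ c σ u.hat) (ξ₀, ξ) * (starRingEnd ℂ) (V (ξ₀, ξ)) := by
    filter_upwards [hsl1, hsl2] with ξ₀ h1 h2
    simp only [hsplit]
    exact h1.sub h2
  have hle := lintegral_slice_pairing_le hσ (s := 1 / 2) (h.meas.sub hdm) hVE.meas
    (hVE.stNorm_lt_top hσ (by norm_num)) hFV hort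
  rw [← neg_div] at hle
  refine le_trans ?_ hle
  refine le_trans ?_ (enorm_integral_le_lintegral_enorm _)
  rw [← ofReal_norm]
  refine ENNReal.ofReal_le_ofReal (le_trans (le_of_eq ?_) (Complex.re_le_norm _))
  rw [← h.pairing_sub hσ hGb hL, ← hV, pairing, pairing, ← mul_sub,
    mul_inv_cancel_left₀ (by positivity), ← Complex.sub_re]
  -- `V` is only the transform of a difference, so integrability is assembled from `v` and `w`.
  have hJ1 : Integrable fun ξ₀ : ℝ => ∫ ξ : Plane, h.hat (ξ₀, ξ) * (starRingEnd ℂ) (V (ξ₀, ξ)) := by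
    refine ((h.integrable_pairing hσ hGb hL v).sub (h.integrable_pairing hσ hGb hL w)).congr ?_
    filter_upwards [h.ae_integrable_slice hσ v.finiteEnergy,
      h.ae_integrable_slice hσ w.finiteEnergy] with ξ₀ h1 h2
    rw [Pi.sub_apply, ← integral_sub h1 h2]
    congr 1; ext ξ
    simp only [hV, Pi.sub_apply, map_sub]
    ring
  rw [← integral_sub hJ1 hint.integral_prod_left]
  congr 1
  refine integral_congr_ae ?_
  filter_upwards [hsl1, hsl2] with ξ₀ h1 h2
  rw [← integral_sub h1 h2]
  simp only [hsplit]

end Load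

/-- Absorption of the error in Young's inequality. -/
theorem sq_le_of_coercive {κ M : ℝ} (hκ : 0 < κ) (hM : 0 < M) {X D T : ℝ≥0∞} (hX : X ≠ ⊤)
    (hD : D ≠ ⊤) (h : ENNReal.ofReal κ * X ^ 2 ≤ T + ENNReal.ofReal M * (X * D)) :
    X ^ 2 ≤ ENNReal.ofReal (2 / κ + (M / κ) ^ 2) * (T + D ^ 2) := by
  have hC : 0 < 2 / κ + (M / κ) ^ 2 := by positivity
  -- `T` will carry the residual norm, whose finiteness is not assumed; if it is infinite the bound
  -- is trivial.
  by_cases hT : T = ⊤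
  · have : ENNReal.ofReal (2 / κ + (M / κ) ^ 2) ≠ 0 := by simpa using hC
    simp [hT, ENNReal.mul_top this]
  lift X to ℝ≥0 using hX
  lift D to ℝ≥0 using hD
  lift T to ℝ≥0 using hT
  simp only [ENNReal.ofReal] at h ⊢
  norm_cast at h ⊢
  rw [← NNReal.coe_le_coe] at h ⊢
  push_cast at h ⊢
  rw [Real.coe_toNNReal _ hκ.le, Real.coe_toNNReal _ hM.le] at h
  rw [Real.coe_toNNReal _ hC.le]
  have hT0 : (0 : ℝ) ≤ T := T.2
  -- Young's inequality, balanced so that half of the coercive term remains; this fixes the constant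
  -- `2/κ + (M/κ)²`.
  have h1 : M * (X * D) ≤ κ / 2 * X ^ 2 + M ^ 2 / (2 * κ) * D ^ 2 := by
    have : 0 ≤ κ / 2 * (X - M / κ * D : ℝ) ^ 2 := by positivity
    have e : κ / 2 * (X - M / κ * D : ℝ) ^ 2 =
        κ / 2 * X ^ 2 + M ^ 2 / (2 * κ) * D ^ 2 - M * (X * D) := by
      field_simp; ring
    linarith
  have h2 : (X : ℝ) ^ 2 ≤ 2 / κ * T + (M / κ) ^ 2 * D ^ 2 := by
    have h3 : κ / 2 * (X : ℝ) ^ 2 ≤ T + M ^ 2 / (2 * κ) * D ^ 2 := by linarith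
    have h4 := mul_le_mul_of_nonneg_left h3 (by positivity : 0 ≤ 2 / κ)
    calc (X : ℝ) ^ 2 = 2 / κ * (κ / 2 * (X : ℝ) ^ 2) := by field_simp
      _ ≤ _ := h4
      _ = _ := by field_simp
  have h5 : 0 ≤ 2 / κ * (D : ℝ) ^ 2 := by positivity
  have h6 : 0 ≤ (M / κ) ^ 2 * (T : ℝ) := by positivity
  nlinarith

end Final

end FlatContact

open FlatContact in
theorem theorem5p1 (μ c σ : ℝ) (hμ : 0 < μ) (hc : 0 < c) (hσ : 0 < σ) :
    ∃ C : ℝ≥0, ∀ (G : Opens Plane), Bornology.IsBounded (G : Set Plane) →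
      IsLipschitzSet (G : Set Plane) →
      ∀ (𝒯 : Triangulation (G : Set Plane)) (Δt : ℝ) (N : ℕ∞) (p q : ℕ),
      0 < Δt → 1 ≤ p → 1 ≤ q →
      ∀ (h : HQuot σ (3 / 2) (-1 / 2) G) (u uh : HTilde σ (1 / 2) (1 / 2) (G : Set Plane)),
      SolvesVI μ c h (nonnegCone σ (1 / 2) (1 / 2) (G : Set Plane)) u →
      SolvesVI μ c h (discreteCone σ 𝒯 Δt N p q) uh →
      stNorm σ (-1 / 2) (1 / 2) (u.hat - uh.hat) ^ 2 ≤
        (C : ℝ≥0∞) * ⨅ φ ∈ discreteCone σ 𝒯 Δt N p q,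
          (stQuotNorm σ (1 / 2) (-1 / 2) (G : Set Plane) (h.hat - dtn μ c σ u.hat) *
              stNorm σ (-1 / 2) (1 / 2) (u.hat - φ.hat) +
            stNorm σ (1 / 2) (1 / 2) (u.hat - φ.hat) ^ 2) := by
  obtain ⟨κ, hκ, hS⟩ := exists_dtnSymbol_re_ge hμ hc hσ
  obtain ⟨M, hM, hMS⟩ := exists_norm_dtnSymbol_le σ hμ hc
  refine ⟨(2 / κ + (M / κ) ^ 2).toNNReal, ?_⟩
  intro G hGb hL 𝒯 Δt N p q _ _ _ h u uh hu huh
  set C : ℝ≥0∞ := ((2 / κ + (M / κ) ^ 2).toNNReal : ℝ≥0∞) with hC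
  have hC0 : C ≠ 0 := by
    have : 0 < 2 / κ + (M / κ) ^ 2 := by positivity
    simpa [hC] using this
  have key : ∀ φ ∈ discreteCone σ 𝒯 Δt N p q, stNorm σ (-1 / 2) (1 / 2) (u.hat - uh.hat) ^ 2 ≤
      C * (stQuotNorm σ (1 / 2) (-1 / 2) (G : Set Plane) (h.hat - dtn μ c σ u.hat) *
              stNorm σ (-1 / 2) (1 / 2) (u.hat - φ.hat) +
            stNorm σ (1 / 2) (1 / 2) (u.hat - φ.hat) ^ 2) := by
    intro φ hφ
    have v1 := hu.2 uh (discreteCone_subset_nonnegCone 𝒯 Δt N p q huh.1)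
    have v2 := huh.2 φ hφ
    have eu := u.finiteEnergy
    have euh := uh.finiteEnergy
    have eφ := φ.finiteEnergy
    have he := eu.sub euh
    have hd := eu.sub eφ
    rw [h.pairing_sub hσ hGb hL, pairing_dtn_sub_right hμ hc hσ eu euh eu] at v1
    rw [h.pairing_sub hσ hGb hL, pairing_dtn_sub_right hμ hc hσ euh eφ euh] at v2
    have b1 := stNorm_sq_le_pairing_dtn hμ hc hσ hκ hS he
    have b2 := h.ofReal_residual_le hσ hGb hL hμ hc u u φ
    have b3 := ofReal_pairing_dtn_le hμ hc hσ hMS he hd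
    -- The finiteness of the error norm, needed for absorption, comes from the finite energy of both
    -- solutions.
    refine sq_le_of_coercive hκ hM (he.stNorm_lt_top hσ (by norm_num)).ne hd.finite.ne
      (b1.trans (le_trans ?_ (add_le_add b2 b3)))
    refine le_trans (ENNReal.ofReal_le_ofReal ?_) ENNReal.ofReal_add_le
    rw [← mul_add]
    refine mul_le_mul_of_nonneg_left ?_ (by positivity)
    -- Expanded by bilinearity, the claim `⟨S e, e⟩ ≤ ⟨h - S u, u - φ⟩ + ⟨S e, u - φ⟩` is the sum of
    -- `v1` and `v2`.
    rw [pairing_dtn_sub_left hμ hc hσ eu euh he, pairing_dtn_sub_left hμ hc hσ eu euh hd,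
      pairing_dtn_sub_right hμ hc hσ eu eu euh, pairing_dtn_sub_right hμ hc hσ euh eu euh,
      pairing_dtn_sub_right hμ hc hσ eu eu eφ, pairing_dtn_sub_right hμ hc hσ euh eu eφ]
    linarith
  -- Dividing by the nonzero finite `C` allows the bound to be taken inside the infimum.
  calc _ = C * (stNorm σ (-1 / 2) (1 / 2) (u.hat - uh.hat) ^ 2 / C) := by
        rw [ENNReal.mul_div_cancel hC0 ENNReal.coe_ne_top]
    _ ≤ _ := by
        gcongr
        exact le_iInf₂ fun φ hφ => ENNReal.div_le_of_le_mul' (key φ hφ)
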